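/- Let $\alpha<\beta\le\alpha+2\pi$ and let $\angle(\alpha,\beta)=\{\rho e^{i\theta}:\rho>0,\ \alpha<\theta<\beta\}$. For real $s$ and $z=\rho e^{i(\alpha+\varphi)}$ with $\rho>0$, $0<\varphi<2\pi$, put $(ze^{-i\alpha})^{s}=\rho^{s}e^{is\varphi}$, and let $\tilde z=(ze^{-i\alpha})^{\pi/(\beta-\alpha)}$, a conformal map of $\angle(\alpha,\beta)$ onto the upper half-plane. For a bounded Borel set $B\subset\mathbb C$ let $\tilde B\subset\mathbb R$ be the set of all $t$ such that $|t|^{(\beta-\alpha)/\pi}e^{i\alpha}\in B$ (if $t\ge 0$), respectively $|t|^{(\beta-\alpha)/\pi}e^{i\beta}\in B$ (if $t<0$). For an integer $q\ge0$ and $z\in\angle(\alpha,\beta)$, the harmonic charge of genus $q$ for the angle is $$\Omega^{[q]}(z,B)=\frac1\pi\int_{\tilde B}\operatorname{Im}\frac{1}{t-\tilde z}\,dt+\frac1\pi\int_{\tilde B}\operatorname{Im}\frac{t^q-\tilde z^{\,q}}{\tilde z^{\,q}(t-\tilde z)}\,dt .$$ A charge is a real-valued Radon measure on $\mathbb C$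 (a difference of two positive, locally finite Borel measures); $|\nu|$ is the total variation of $\nu$, $D(r)=\{|z|<r\}$, and $|\nu|^{\mathrm{rad}}(r)=|\nu|(\{|z|\le r\})$. The charge $\nu$ is of finite type at order $p$ (near $\infty$) if $\limsup_{r\to+\infty}|\nu|^{\mathrm{rad}}(r)/r^p<+\infty$. The genus-$q$ balayage of $\nu$ from $\angle(\alpha,\beta)$, if it exists, is the charge $\nu^{\mathrm{bal}[q]}$ such that for every bounded Borel set $B$ the integral below converges absolutely and $$\nu^{\mathrm{bal}[q]}(B)=\int_{\angle(\alpha,\beta)}\Omega^{[q]}(z,B)\,d\nu(z)+\nu\bigl(B\setminus\angle(\alpha,\beta)\bigr).$$ **Theorem.** Let $p\ge 0$ be real, let $\nu$ be a charge of finite type at order $p$ with $0\notin\operatorname{supp}\nu$, and let $q=\bigl[\frac{\beta-\alpha}{\pi}p\bigr]$ be the integer part of $\frac{\beta-\alpha}{\pi}p$. Below, $r_0>0$ is any number with $D(r_0)\cap\operatorname{supp}\nu=\varnothing$. 1. The genus-$q$ balayage $\nu^{\mathrm{bal}[q]}$ of $\nu$ from $\angle(\alpha,\beta)$ exists (and is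 unique), and there is a constant $C$ depending only on $\nu,p,\alpha,\beta$ such that for all $r\ge0$ $$|\nu^{\mathrm{bal}[q]}|^{\mathrm{rad}}(r)\le C\Bigl(r^p+r^{\frac{\pi q}{\beta-\alpha}}\Bigl|\int_{(D(r)\setminus D(r_0))\cap\angle(\alpha,\beta)}\operatorname{Im}\frac{1}{(ze^{-i\alpha})^{\pi q/(\beta-\alpha)}}\,d\nu(z)\Bigr|\Bigr).$$ 2. For every such $p$, $|\nu^{\mathrm{bal}[q]}|^{\mathrm{rad}}(r)=O(r^p\log r)$ as $r\to+\infty$. 3. If $\frac{\beta-\alpha}{\pi}p$ is not an integer, then $\nu^{\mathrm{bal}[q]}$ is of finite type at order $p$. 4. If $\frac{\beta-\alpha}{\pi}p$ is an integer (so that $q=\frac{\beta-\alpha}{\pi}p$ and $\frac{\pi q}{\beta-\alpha}=p$) and $\nu$ satisfies the Blaschke condition of genus $p$ in $\angle(\alpha,\beta)$, $$\Bigl|\int_{(D(r)\setminus D(r_0))\cap\angle(\alpha,\beta)}\operatorname{Im}\frac{1}{(ze^{-i\alpha})^{p}}\,d\nu(z)\Bigr|=O(1),\qquad r\to+\infty,$$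 then $\nu^{\mathrm{bal}[q]}$ is of finite type at order $p$. The case $(\alpha,\beta)=(0,2\pi)$ is the balayage from $\mathbb C\setminus[0,+\infty)$ onto $[0,+\infty)$, with $q=[2p]$. -/

import Mathlib

open MeasureTheory Filter Asymptotics
open scoped ENNReal Topology

/-- A charge on the complex plane, that is, a real Radon (locally finite signed Borel) measure,
given by its Jordan decomposition: the upper variation `pos` and the lower variation `neg` are
mutually singular, locally finite Borel measures. (Both variations may have infinite total
mass, so Mathlib's `SignedMeasure` is too small.) -/
@[ext]
structure Charge where
  /-- The upper variation. -/
  pos : Measure ℂ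
  /-- The lower variation. -/
  neg : Measure ℂ
  pos_locallyFinite : IsLocallyFiniteMeasure pos
  neg_locallyFinite : IsLocallyFiniteMeasure neg
  mutuallySingular : pos ⟂ₘ neg

attribute [instance] Charge.pos_locallyFinite Charge.neg_locallyFinite

namespace Charge

/-- The total variation of a charge. -/
noncomputable def tv (ν : Charge) : Measure ℂ := ν.pos + ν.neg

/-- The value of a charge on a set; meaningful for bounded Borel sets. -/
noncomputable def value (ν : Charge) (B : Set ℂ) : ℝ := ν.pos.real B - ν.neg.real B

/-- The integral of `f` over the set `S` against a charge; meaningful when `f` is integrable over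
`S` against the total variation. -/
noncomputable def setIntegral (ν : Charge) (S : Set ℂ) (f : ℂ → ℝ) : ℝ :=
  (∫ z in S, f z ∂ν.pos) - ∫ z in S, f z ∂ν.neg

/-- The (closed) support of a charge. -/
def support (ν : Charge) : Set ℂ := ν.tv.support

/-- The radial counting function of the total variation: its mass on the closed disc of radius
`r` about `0`. -/
noncomputable def radTV (ν : Charge) (r : ℝ) : ℝ := ν.tv.real (Metric.closedBall 0 r)

/-- The type of a charge at order `p` near infinity:
the upper limit of `|ν|(closed disc of radius r) / r ^ p` as `r → +∞`. -/
noncomputable def typeAtInfty (ν : Charge) (p : ℝ) : ℝ≥0∞ :=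
  limsup (fun r : ℝ => ν.tv (Metric.closedBall 0 r) / ENNReal.ofReal (r ^ p)) atTop

/-- The charge is of finite type at order `p` near infinity. -/
def FiniteType (ν : Charge) (p : ℝ) : Prop := ν.typeAtInfty p < ⊤

end Charge

/-- The open angle `∠(α, β)` with vertex `0`. -/
def openAngle (α β : ℝ) : Set ℂ :=
  {z | ∃ ρ θ : ℝ, 0 < ρ ∧ α < θ ∧ θ < β ∧ z = (ρ : ℂ) * Complex.exp ((θ : ℂ) * Complex.I)}

/-- The branch of the argument of `z * exp (-i α)` that lies in `(0, 2π)` when `z` is off the ray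
`{ρ * exp (i α) : ρ ≥ 0}`. -/
noncomputable def argFrom (α : ℝ) (z : ℂ) : ℝ :=
  Complex.arg (-(z * Complex.exp (-(α : ℂ) * Complex.I))) + Real.pi

/-- The power `(z * exp (-i α)) ^ s`, analytic off the ray `{ρ * exp (i α) : ρ ≥ 0}`, in the branch
with positive boundary values on that ray from the side of arguments larger than `α`:
`ρ * exp (i (α + φ))` with `ρ > 0`, `0 < φ < 2π` is sent to `ρ ^ s * exp (i s φ)`. -/
noncomputable def anglePow (α s : ℝ) (z : ℂ) : ℂ :=
  ((‖z‖ ^ s : ℝ) : ℂ) * Complex.exp (((s * argFrom α z : ℝ) : ℂ) * Complex.I)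

/-- The conformal map `z ↦ (z * exp (-i α)) ^ (π / (β - α))` of `∠(α, β)` onto the upper
half-plane. -/
noncomputable def angleMap (α β : ℝ) (z : ℂ) : ℂ := anglePow α (Real.pi / (β - α)) z

/-- The boundary parametrization of the angle that is inverse to the conformal map: positive `t`
run through the side of argument `α` and negative `t` through the side of argument `β`. When
`β = α + 2π` the common ray is covered twice. -/
noncomputable def angleBoundary (α β : ℝ) (t : ℝ) : ℂ :=
  ((|t| ^ ((β - α) / Real.pi) : ℝ) : ℂ) *
    Complex.exp (((if 0 ≤ t then α else β : ℝ) : ℂ) * Complex.I)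

/-- The harmonic measure `ω(z, E)` for the upper half-plane of a set `E` on the real axis. -/
noncomputable def harmonicMeasureUpper (z : ℂ) (E : Set ℝ) : ℝ :=
  (1 / Real.pi) * ∫ t in E, (1 / ((t : ℂ) - z)).im

/-- The harmonic charge of genus `q` for the upper half-plane of a bounded Borel set `E` on the
real axis. -/
noncomputable def harmonicChargeUpper (q : ℕ) (z : ℂ) (E : Set ℝ) : ℝ :=
  harmonicMeasureUpper z E +
    (1 / Real.pi) * ∫ t in E, (((t : ℂ) ^ q - z ^ q) / (z ^ q * ((t : ℂ) - z))).im

/-- The harmonic charge of genus `q` for the angle `∠(α, β)`: the point and the part of `B` on the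
two sides of the angle are carried over to the half-plane. -/
noncomputable def harmonicChargeAngle (q : ℕ) (α β : ℝ) (z : ℂ) (B : Set ℂ) : ℝ :=
  harmonicChargeUpper q (angleMap α β z) (angleBoundary α β ⁻¹' B)

/-- `μ` is the balayage of genus `q` of `ν` from `∠(α, β)` onto its complement: for every
bounded Borel set `B` the defining integral converges (absolutely) and yields `μ(B)`. -/
def IsAngleBalayage (q : ℕ) (α β : ℝ) (ν μ : Charge) : Prop :=
  ∀ B : Set ℂ, MeasurableSet B → Bornology.IsBounded B →
    IntegrableOn (fun z => harmonicChargeAngle q α β z B) (openAngle α β) ν.tv ∧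
    μ.value B = ν.setIntegral (openAngle α β) (fun z => harmonicChargeAngle q α β z B) +
      ν.value (B \ openAngle α β)

/-- The integral of `Im ((z * exp (-i α)) ^ (-s))` against `ν` over the part of the angle `∠(α, β)`
with `r₀ ≤ |z| < r`. -/
noncomputable def angleMoment (ν : Charge) (α β s r₀ r : ℝ) : ℝ :=
  ν.setIntegral ((Metric.ball 0 r \ Metric.ball 0 r₀) ∩ openAngle α β)
    (fun z => (1 / anglePow α s z).im)

/-- The Blaschke condition of genus `p` near infinity in the angle `∠(α, β)`. -/
def BlaschkeCondition (ν : Charge) (α β p r₀ : ℝ) : Prop :=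
  (fun r : ℝ => |angleMoment ν α β p r₀ r|) =O[atTop] (fun _ : ℝ => (1 : ℝ))

/-!
The balayage of genus `q` from an angle and the growth of its total variation.

Put `s = π / (β - α)`, let `w` be the image of `z` in the upper half-plane, so `|w| = |z| ^ s`, and
`R = r ^ s`. The harmonic charge has density `Im (t ^ q / (w ^ q (t - w))) / π` on the real axis.
Since
`t ^ (k + 1) / (w ^ (k + 1) (t - w)) = t ^ k / (w ^ k (t - w)) + t ^ k / w ^ (k + 1)`,
the density is the Poisson kernel plus the terms `t ^ (m - 1) Im (w ^ (-m)) / π`, `1 ≤ m ≤ q`.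
As the Poisson kernel has integral `π`, the absolute density has mass `O((R / |w|) ^ q)` on
`[-R, R]` when `|w| < R`; when `|w| ≥ R` its mass is `O((R / |w|) ^ (q + 1))`
(`integral_abs_genusKernel_le`).

A charge of finite type at order `p` with no mass near the origin satisfies
`|ν|(|z| ≤ r) ≤ A r ^ p` for all `r ≥ 0`, and the layer cake formula turns this into bounds for the
integrals of `(r / |z|) ^ a`: over `|z| ≥ r` they are `O(r ^ p)` for `a > p`, over `|z| < r` they
are `O(r ^ p)` for `a < p`, and a logarithm appears for `a = p`. Since `s q ≤ p < s (q + 1)`, the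
kernel is absolutely integrable; by Fubini the swept measure is a difference of two locally finite
measures, whose Jordan decomposition is the balayage (`exists_isAngleBalayage`). A charge is
determined by its values on bounded Borel sets, and a bound for these values on all Borel subsets
of a disc bounds the total variation of the disc up to a factor `2`.

The same majorant gives `O(r ^ p log r)`, and `O(r ^ p)` if `s q < p`. For the sharper bound, the
only term that may fail to be `O(r ^ p)` is the one with `m = q` over `|z| < r`; it equals the
moment `∫ Im (w ^ (-q)) dν` over that part of the angle, times a number of absolute value at most
`R ^ q`. The remainder has the majorant with `(R / |w|) ^ (q - 1)` inside the disc, whose integral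
is `O(r ^ p)` (`exists_abs_setIntegral_harmonicChargeAngle_le`).
-/

/-! ### The kernel of genus `q` for the upper half-plane -/

/-- The density (up to the factor `1 / π`) of the harmonic charge of genus `q` of the upper
half-plane: `Im (t ^ q / (w ^ q * (t - w)))`. For `q = 0` it is the Poisson kernel. -/
noncomputable def genusKernel (q : ℕ) (w : ℂ) (t : ℝ) : ℝ :=
  ((t : ℂ) ^ q / (w ^ q * ((t : ℂ) - w))).im

lemma ofReal_sub_ne_zero_of_im_pos {w : ℂ} (hw : 0 < w.im) (t : ℝ) : (t : ℂ) - w ≠ 0 := by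
  intro h
  have := congrArg Complex.im h
  simp at this
  exact hw.ne' this

lemma ne_zero_of_im_pos {w : ℂ} (hw : 0 < w.im) : w ≠ 0 := by
  rintro rfl
  simp at hw

lemma continuous_genusKernel (q : ℕ) {w : ℂ} (hw : 0 < w.im) : Continuous (genusKernel q w) := by
  unfold genusKernel
  refine Complex.continuous_im.comp (Continuous.div (by fun_prop) (by fun_prop) fun t => ?_)
  exact mul_ne_zero (pow_ne_zero _ (ne_zero_of_im_pos hw)) (ofReal_sub_ne_zero_of_im_pos hw t)

lemma genusKernel_zero (w : ℂ) (t : ℝ) : genusKernel 0 w t = (1 / ((t : ℂ) - w)).im := by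
  simp [genusKernel]

lemma genusKernel_zero_eq_cauchyPDFReal {w : ℂ} (hw : 0 < w.im) (t : ℝ) :
    genusKernel 0 w t =
      Real.pi * ProbabilityTheory.cauchyPDFReal w.re w.im.toNNReal t := by
  have h : Complex.normSq ((t : ℂ) - w) = (t - w.re) ^ 2 + w.im ^ 2 := by
    simp [Complex.normSq_apply]; ring
  rw [genusKernel_zero, ProbabilityTheory.cauchyPDFReal_def, one_div, Complex.inv_im, h]
  have := Real.pi_ne_zero
  simp only [Complex.sub_im, Complex.ofReal_im, Real.coe_toNNReal _ hw.le, zero_sub, neg_neg]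
  field_simp

lemma genusKernel_zero_nonneg {w : ℂ} (hw : 0 < w.im) (t : ℝ) : 0 ≤ genusKernel 0 w t := by
  rw [genusKernel_zero_eq_cauchyPDFReal hw]
  exact mul_nonneg Real.pi_pos.le
    (ProbabilityTheory.cauchyPDF_pos w.re (Real.toNNReal_pos.2 hw).ne' t).le

lemma integrable_genusKernel_zero {w : ℂ} (hw : 0 < w.im) : Integrable (genusKernel 0 w) := by
  rw [funext (genusKernel_zero_eq_cauchyPDFReal hw)]
  exact (ProbabilityTheory.integrable_cauchyPDFReal w.re).const_mul _

lemma integral_genusKernel_zero {w : ℂ} (hw : 0 < w.im) :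
    ∫ t, genusKernel 0 w t = Real.pi := by
  simp_rw [genusKernel_zero_eq_cauchyPDFReal hw]
  rw [integral_const_mul,
    ProbabilityTheory.integral_cauchyPDFReal_eq_one _ (Real.toNNReal_pos.2 hw).ne', mul_one]

lemma genusKernel_succ (q : ℕ) {w : ℂ} (hw : 0 < w.im) (t : ℝ) :
    genusKernel (q + 1) w t = genusKernel q w t + t ^ q * (1 / w ^ (q + 1)).im := by
  have h0 := ne_zero_of_im_pos hw
  have h1 := ofReal_sub_ne_zero_of_im_pos hw t
  have : (t : ℂ) ^ (q + 1) / (w ^ (q + 1) * ((t : ℂ) - w)) =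
      (t : ℂ) ^ q / (w ^ q * ((t : ℂ) - w)) + ((t ^ q : ℝ) : ℂ) * (1 / w ^ (q + 1)) := by
    push_cast
    field_simp
    ring
  rw [genusKernel, this, Complex.add_im, Complex.im_ofReal_mul, ← genusKernel]

lemma integrableOn_genusKernel (q : ℕ) {w : ℂ} (hw : 0 < w.im) {E : Set ℝ}
    (hE : Bornology.IsBounded E) : IntegrableOn (genusKernel q w) E := by
  obtain ⟨R, hR⟩ := hE.subset_closedBall 0
  exact ((continuous_genusKernel q hw).continuousOn.integrableOn_compact
    (isCompact_closedBall 0 R)).mono_set hR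

lemma harmonicChargeUpper_eq (q : ℕ) {w : ℂ} (hw : 0 < w.im) {E : Set ℝ}
    (hE : Bornology.IsBounded E) :
    harmonicChargeUpper q w E = (1 / Real.pi) * ∫ t in E, genusKernel q w t := by
  have hs (t : ℝ) : (((t : ℂ) ^ q - w ^ q) / (w ^ q * ((t : ℂ) - w))).im =
      genusKernel q w t - genusKernel 0 w t := by
    have h0 := ne_zero_of_im_pos hw
    have h1 := ofReal_sub_ne_zero_of_im_pos hw t
    rw [genusKernel_zero, genusKernel, ← Complex.sub_im]
    congr 1
    field_simp
  rw [harmonicChargeUpper, harmonicMeasureUpper, ← mul_add]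
  congr 1
  simp_rw [hs, ← genusKernel_zero]
  rw [integral_sub (integrableOn_genusKernel q hw hE) (integrableOn_genusKernel 0 hw hE)]
  ring

/-- Raising the genus by one adds a multiple of the moment kernel `Im (w ^ (-(q + 1)))`. -/
lemma harmonicChargeUpper_succ (q : ℕ) {w : ℂ} (hw : 0 < w.im) {E : Set ℝ}
    (hE : Bornology.IsBounded E) :
    harmonicChargeUpper (q + 1) w E = harmonicChargeUpper q w E +
      ((1 / Real.pi) * ∫ t in E, t ^ q) * (1 / w ^ (q + 1)).im := by
  obtain ⟨R, hR⟩ := hE.subset_closedBall 0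
  have hi : IntegrableOn (fun t : ℝ => t ^ q * (1 / w ^ (q + 1)).im) E :=
    ((Continuous.continuousOn (by fun_prop)).integrableOn_compact
      (isCompact_closedBall 0 R)).mono_set hR
  rw [harmonicChargeUpper_eq _ hw hE, harmonicChargeUpper_eq _ hw hE]
  simp_rw [genusKernel_succ q hw]
  rw [integral_add (integrableOn_genusKernel q hw hE) hi, integral_mul_const]
  ring

lemma abs_one_div_pow_im_le (w : ℂ) (m : ℕ) : |(1 / w ^ m).im| ≤ 1 / ‖w‖ ^ m := by
  refine (Complex.abs_im_le_norm _).trans ?_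
  simp

lemma abs_genusKernel_le_sum (q : ℕ) {w : ℂ} (hw : 0 < w.im) {R t : ℝ} (ht : |t| ≤ R) :
    |genusKernel q w t| ≤
      genusKernel 0 w t + ∑ m ∈ Finset.range q, R ^ m / ‖w‖ ^ (m + 1) := by
  induction q with
  | zero => simp [abs_of_nonneg (genusKernel_zero_nonneg hw t)]
  | succ q ih =>
    rw [genusKernel_succ q hw, Finset.sum_range_succ, ← add_assoc]
    refine (abs_add_le _ _).trans (add_le_add ih ?_)
    rw [abs_mul, abs_pow, div_eq_mul_one_div (R ^ q)]
    exact mul_le_mul (pow_le_pow_left₀ (abs_nonneg t) ht q) (abs_one_div_pow_im_le w _)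
      (abs_nonneg _) (pow_nonneg ((abs_nonneg t).trans ht) q)

lemma integral_abs_genusKernel_le_sum (q : ℕ) {w : ℂ} (hw : 0 < w.im) {R : ℝ} (hR : 0 < R) :
    ∫ t in Set.Icc (-R) R, |genusKernel q w t| ≤
      Real.pi + 2 * ∑ m ∈ Finset.range q, (R / ‖w‖) ^ (m + 1) := by
  have hb : Bornology.IsBounded (Set.Icc (-R) R) := Metric.isBounded_Icc _ _
  have hsum : 2 * R * ∑ m ∈ Finset.range q, R ^ m / ‖w‖ ^ (m + 1) =
      2 * ∑ m ∈ Finset.range q, (R / ‖w‖) ^ (m + 1) := by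
    rw [mul_assoc, Finset.mul_sum]
    congr 1
    refine Finset.sum_congr rfl fun m _ => ?_
    rw [div_pow, pow_succ R]
    ring
  have hle : ∀ t ∈ Set.Icc (-R) R, |genusKernel q w t| ≤
      genusKernel 0 w t + ∑ m ∈ Finset.range q, R ^ m / ‖w‖ ^ (m + 1) :=
    fun t ht => abs_genusKernel_le_sum q hw (abs_le.2 ht)
  rw [← hsum]
  generalize ∑ m ∈ Finset.range q, R ^ m / ‖w‖ ^ (m + 1) = c at hle
  have h0 := integrableOn_genusKernel 0 hw hb
  have hc : IntegrableOn (fun _ : ℝ => c) (Set.Icc (-R) R) :=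
    integrableOn_const measure_Icc_lt_top.ne
  calc ∫ t in Set.Icc (-R) R, |genusKernel q w t|
      ≤ ∫ t in Set.Icc (-R) R, (genusKernel 0 w t + c) :=
        setIntegral_mono_on (integrableOn_genusKernel q hw hb).abs
          (h0.add hc) measurableSet_Icc hle
    _ = (∫ t in Set.Icc (-R) R, genusKernel 0 w t) + 2 * R * c := by
        rw [integral_add h0 hc, setIntegral_const, Measure.real, Real.volume_Icc,
          ENNReal.toReal_ofReal (by linarith), smul_eq_mul]
        ring
    _ ≤ _ := by
        gcongr
        rw [← integral_genusKernel_zero hw]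
        exact setIntegral_le_integral (integrable_genusKernel_zero hw)
          (Eventually.of_forall (genusKernel_zero_nonneg hw))

lemma abs_genusKernel_le_of_two_mul_le (q : ℕ) {w : ℂ} (hw : 0 < w.im) {R t : ℝ}
    (hR : 0 < R) (ht : |t| ≤ R) (hwR : 2 * R ≤ ‖w‖) :
    |genusKernel q w t| ≤ 2 / R * (R / ‖w‖) ^ (q + 1) := by
  have hw0 : 0 < ‖w‖ := norm_pos_iff.2 (ne_zero_of_im_pos hw)
  have hd : ‖w‖ / 2 ≤ ‖(t : ℂ) - w‖ := by
    have := norm_sub_norm_le w (t : ℂ)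
    rw [norm_sub_rev, Complex.norm_real, Real.norm_eq_abs] at this
    linarith
  calc |genusKernel q w t| ≤ |t| ^ q / (‖w‖ ^ q * ‖(t : ℂ) - w‖) := by
        refine (Complex.abs_im_le_norm _).trans ?_
        simp
    _ ≤ R ^ q / (‖w‖ ^ q * (‖w‖ / 2)) := by gcongr
    _ = _ := by
        rw [div_pow, pow_succ R, pow_succ ‖w‖]
        field_simp

/-- A majorant with two powers: `x ^ a` for `x > 1` and `x ^ b` for `x ≤ 1`. With `x = R / |w|`,
`a = q` and `b = q + 1` it governs the mass of the genus-`q` kernel on `[-R, R]`. -/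
noncomputable def powerWeight (a b : ℕ) (x : ℝ) : ℝ := if 1 < x then x ^ a else x ^ b

/-- The constant serves three regimes: for `|w| < R` and `R ≤ |w| < 2 R` the expansion into powers
is used, and in the second one `1 ≤ (2 R / |w|) ^ (q + 1)` accounts for the power of `2`; for
`|w| ≥ 2 R` the denominator `t - w` is at least `|w| / 2`. -/
lemma integral_abs_genusKernel_le (q : ℕ) {w : ℂ} (hw : 0 < w.im) {R : ℝ} (hR : 0 < R) :
    ∫ t in Set.Icc (-R) R, |genusKernel q w t| ≤
      ((Real.pi + 2 * q) * 2 ^ (q + 1)) * powerWeight q (q + 1) (R / ‖w‖) := by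
  have hw0 : 0 < ‖w‖ := norm_pos_iff.2 (ne_zero_of_im_pos hw)
  have hb : Bornology.IsBounded (Set.Icc (-R) R) := Metric.isBounded_Icc _ _
  have hpi : 0 ≤ Real.pi + 2 * q := by positivity
  have h2 : (1 : ℝ) ≤ 2 ^ (q + 1) := one_le_pow₀ (by norm_num)
  have hsum := integral_abs_genusKernel_le_sum q hw hR
  set x := R / ‖w‖ with hx
  have hx0 : 0 < x := by positivity
  unfold powerWeight
  split_ifs with h1
  · refine hsum.trans ?_
    have hs : ∑ m ∈ Finset.range q, x ^ (m + 1) ≤ q * x ^ q := by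
      refine (Finset.sum_le_card_nsmul _ _ (x ^ q) fun m hm => ?_).trans (by simp)
      exact pow_le_pow_right₀ h1.le (Finset.mem_range.1 hm)
    have h3 : 1 ≤ x ^ q := one_le_pow₀ h1.le
    calc Real.pi + 2 * ∑ m ∈ Finset.range q, x ^ (m + 1)
        ≤ Real.pi * x ^ q + 2 * (q * x ^ q) := by
          gcongr
          exact le_mul_of_one_le_right Real.pi_pos.le h3
      _ = (Real.pi + 2 * q) * 1 * x ^ q := by ring
      _ ≤ _ := by gcongr
  · rw [not_lt] at h1
    rcases le_total (2 * R) ‖w‖ with h | h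
    · have hc : IntegrableOn (fun _ : ℝ => 2 / R * x ^ (q + 1)) (Set.Icc (-R) R) :=
        integrableOn_const (by simp)
      calc ∫ t in Set.Icc (-R) R, |genusKernel q w t|
          ≤ ∫ t in Set.Icc (-R) R, 2 / R * x ^ (q + 1) :=
            setIntegral_mono_on (integrableOn_genusKernel q hw hb).abs hc measurableSet_Icc
              fun t ht => abs_genusKernel_le_of_two_mul_le q hw hR (abs_le.2 ht) h
        _ = 2 * 2 * x ^ (q + 1) := by
            rw [setIntegral_const, Measure.real, Real.volume_Icc,
              ENNReal.toReal_ofReal (by linarith), smul_eq_mul]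
            field_simp
            ring
        _ ≤ _ := by
            gcongr
            · nlinarith [Real.pi_gt_three, (Nat.cast_nonneg q : (0 : ℝ) ≤ q)]
            · exact le_self_pow₀ (by norm_num) (by simp)
    · refine hsum.trans ?_
      have hs : ∑ m ∈ Finset.range q, x ^ (m + 1) ≤ q :=
        (Finset.sum_le_card_nsmul _ _ 1 fun m _ => pow_le_one₀ hx0.le h1).trans (by simp)
      have h3 : 1 ≤ (2 * x) ^ (q + 1) := by
        refine one_le_pow₀ ?_
        rw [hx, ← mul_div_assoc, one_le_div hw0]
        exact h
      calc Real.pi + 2 * ∑ m ∈ Finset.range q, x ^ (m + 1) ≤ (Real.pi + 2 * q) * 1 := by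
            linarith
        _ ≤ (Real.pi + 2 * q) * (2 * x) ^ (q + 1) := by gcongr
        _ = _ := by rw [mul_pow]; ring

lemma abs_integral_pow_le {R : ℝ} (hR : 0 < R) (q : ℕ) {E : Set ℝ}
    (hE : E ⊆ Set.Icc (-R) R) : |(1 / Real.pi) * ∫ t in E, t ^ q| ≤ R ^ (q + 1) := by
  have h1 : |∫ t in E, t ^ q| ≤ R ^ q * (2 * R) := by
    have hfin : volume E ≤ ENNReal.ofReal (2 * R) := by
      refine (measure_mono hE).trans (le_of_eq ?_)
      rw [Real.volume_Icc]; congr 1; ring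
    refine (norm_setIntegral_le_of_norm_le_const (f := fun t : ℝ => t ^ q) (C := R ^ q)
      (hfin.trans_lt ENNReal.ofReal_lt_top) fun t ht => ?_).trans ?_
    · rw [norm_pow]
      exact pow_le_pow_left₀ (norm_nonneg _) (abs_le.2 (hE ht)) q
    · gcongr
      exact ENNReal.toReal_le_of_le_ofReal (by linarith) hfin
  rw [abs_mul, abs_of_pos (by positivity), one_div, inv_mul_le_iff₀ Real.pi_pos]
  refine h1.trans ?_
  rw [pow_succ]
  nlinarith [Real.pi_gt_three, pow_pos hR q, mul_pos (pow_pos hR q) hR]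

/-! ### Power integrals against measures of power growth -/

/-- Layer cake bound. Up to the origin, the superlevel set `{z | t ≤ ρ / |z|}` is the closed disc
of radius `ρ / t`, so `g` is a bound for the mass of discs. -/
lemma lintegral_div_norm_rpow_le (n : Measure ℂ) {ρ a : ℝ} (hρ : 0 < ρ) (ha : 0 < a)
    {g : ℝ → ℝ≥0∞} (hg : ∀ t, 0 < t → n {z | t ≤ ρ / ‖z‖} ≤ g t) :
    ∫⁻ z, ENNReal.ofReal ((ρ / ‖z‖) ^ a) ∂n ≤
      ENNReal.ofReal a * ∫⁻ t in Set.Ioi 0, g t * ENNReal.ofReal (t ^ (a - 1)) := by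
  rw [lintegral_rpow_eq_lintegral_meas_le_mul n
    (Eventually.of_forall fun z => by positivity) (by fun_prop) ha]
  gcongr 1
  refine setLIntegral_mono' measurableSet_Ioi fun t ht => ?_
  gcongr
  exact hg t ht

lemma lintegral_Ioc_zero_one_rpow {b : ℝ} (hb : -1 < b) :
    ∫⁻ t in Set.Ioc (0 : ℝ) 1, ENNReal.ofReal (t ^ b) = ENNReal.ofReal (1 / (b + 1)) := by
  have hi : IntegrableOn (fun t : ℝ => t ^ b) (Set.Ioc 0 1) :=
    (intervalIntegrable_iff_integrableOn_Ioc_of_le zero_le_one).1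
      (intervalIntegral.intervalIntegrable_rpow' hb)
  rw [← ofReal_integral_eq_lintegral_ofReal hi
    ((ae_restrict_iff' measurableSet_Ioc).2 (Eventually.of_forall fun t ht =>
      Real.rpow_nonneg ht.1.le b)),
    ← intervalIntegral.integral_of_le zero_le_one, integral_rpow (Or.inl hb),
    Real.one_rpow, Real.zero_rpow (by linarith), sub_zero]

lemma lintegral_Ioi_one_rpow {b : ℝ} (hb : b < -1) :
    ∫⁻ t in Set.Ioi (1 : ℝ), ENNReal.ofReal (t ^ b) = ENNReal.ofReal (-1 / (b + 1)) := by
  rw [← ofReal_integral_eq_lintegral_ofReal (integrableOn_Ioi_rpow_of_lt hb one_pos)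
    ((ae_restrict_iff' measurableSet_Ioi).2 (Eventually.of_forall fun t ht =>
      Real.rpow_nonneg (zero_le_one.trans (le_of_lt ht)) b)),
    integral_Ioi_rpow_of_lt hb one_pos, Real.one_rpow]

lemma lintegral_Ioc_one_inv {c : ℝ} (hc : 1 ≤ c) :
    ∫⁻ t in Set.Ioc (1 : ℝ) c, ENNReal.ofReal (t ^ (-1 : ℝ)) = ENNReal.ofReal (Real.log c) := by
  have h0 : (0 : ℝ) ∉ Set.uIcc 1 c := by
    rw [Set.uIcc_of_le hc]
    exact fun h => absurd h.1 (by norm_num)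
  have hi : IntegrableOn (fun t : ℝ => t ^ (-1 : ℝ)) (Set.Ioc 1 c) := by
    refine (intervalIntegrable_iff_integrableOn_Ioc_of_le hc).1 ?_
    exact intervalIntegral.intervalIntegrable_rpow (Or.inr h0)
  rw [← ofReal_integral_eq_lintegral_ofReal hi
    ((ae_restrict_iff' measurableSet_Ioc).2 (Eventually.of_forall fun t ht =>
      Real.rpow_nonneg (zero_le_one.trans ht.1.le) _)),
    ← intervalIntegral.integral_of_le hc]
  simp_rw [Real.rpow_neg_one]
  rw [integral_inv h0, div_one]

lemma le_div_norm_subset {ρ t : ℝ} (ht : 0 < t) :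
    {z : ℂ | t ≤ ρ / ‖z‖} ⊆ Metric.closedBall 0 (ρ / t) := by
  intro z hz
  simp only [Set.mem_ofPred_eq] at hz
  rw [mem_closedBall_zero_iff]
  rcases (norm_nonneg z).eq_or_lt with h | h
  · rw [← h, div_zero] at hz
    linarith
  · rw [le_div_iff₀ ht]
    rw [le_div_iff₀ h] at hz
    linarith

/-- The measure has mass at most `A * r ^ p` on every closed disc of radius `r` about `0`. -/
def HasPowerGrowth (n : Measure ℂ) (A p : ℝ) : Prop :=
  ∀ r : ℝ, 0 ≤ r → n (Metric.closedBall 0 r) ≤ ENNReal.ofReal (A * r ^ p)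

lemma HasPowerGrowth.mono {n n' : Measure ℂ} {A p : ℝ} (h : HasPowerGrowth n A p)
    (hn : n' ≤ n) : HasPowerGrowth n' A p := fun r hr => (hn _).trans (h r hr)

lemma HasPowerGrowth.measure_le_div_norm {n : Measure ℂ} {A p ρ t : ℝ}
    (h : HasPowerGrowth n A p) (hρ : 0 < ρ) (ht : 0 < t) :
    n {z | t ≤ ρ / ‖z‖} ≤ ENNReal.ofReal (A * ρ ^ p) * ENNReal.ofReal (t ^ (-p)) := by
  refine (measure_mono (le_div_norm_subset ht)).trans ((h _ (by positivity)).trans (le_of_eq ?_))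
  rw [← ENNReal.ofReal_mul' (by positivity), Real.div_rpow hρ.le ht.le, Real.rpow_neg ht.le]
  congr 1
  ring

lemma ofReal_rpow_mul_ofReal_rpow {t : ℝ} (ht : 0 < t) (a b : ℝ) :
    ENNReal.ofReal (t ^ a) * ENNReal.ofReal (t ^ b) = ENNReal.ofReal (t ^ (a + b)) := by
  rw [← ENNReal.ofReal_mul (by positivity), Real.rpow_add ht]

/-- Outside a disc, `(ρ / |z|) ^ a` is integrable once `a` exceeds the order of growth. -/
lemma HasPowerGrowth.lintegral_outside_le {n : Measure ℂ} {A p ρ a : ℝ}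
    (h : HasPowerGrowth n A p) (hA : 0 ≤ A) (hp : 0 ≤ p) (hρ : 0 < ρ) (ha : p < a) :
    ∫⁻ z in (Metric.ball 0 ρ)ᶜ, ENNReal.ofReal ((ρ / ‖z‖) ^ a) ∂n ≤
      ENNReal.ofReal (a / (a - p) * A * ρ ^ p) := by
  have ha0 : 0 < a := hp.trans_lt ha
  refine (lintegral_div_norm_rpow_le _ hρ ha0 (g := (Set.Iic 1).indicator fun t =>
    ENNReal.ofReal (A * ρ ^ p) * ENNReal.ofReal (t ^ (-p))) fun t ht => ?_).trans ?_
  · by_cases h1 : t ≤ 1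
    · rw [Set.indicator_of_mem (Set.mem_Iic.2 h1)]
      exact (Measure.restrict_apply_le _ _).trans (h.measure_le_div_norm hρ ht)
    · rw [Set.indicator_of_notMem (by simpa using h1), nonpos_iff_eq_zero,
        Measure.restrict_apply (measurableSet_le measurable_const (by fun_prop))]
      convert measure_empty (μ := n)
      rw [Set.eq_empty_iff_forall_notMem]
      rintro z ⟨hz, hz'⟩
      rw [not_le] at h1
      simp only [Set.mem_ofPred_eq, Set.mem_compl_iff, mem_ball_zero_iff, not_lt] at hz hz'
      have : ρ / ‖z‖ ≤ 1 := div_le_one_of_le₀ hz' (norm_nonneg z)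
      linarith
  · have e : ∀ t ∈ Set.Ioi (0 : ℝ), (Set.Iic (1 : ℝ)).indicator (fun t =>
        ENNReal.ofReal (A * ρ ^ p) * ENNReal.ofReal (t ^ (-p))) t * ENNReal.ofReal (t ^ (a - 1)) =
        (Set.Iic (1 : ℝ)).indicator (fun t =>
          ENNReal.ofReal (A * ρ ^ p) * ENNReal.ofReal (t ^ (a - p - 1))) t := by
      intro t ht
      by_cases h1 : t ∈ Set.Iic (1 : ℝ)
      · rw [Set.indicator_of_mem h1, Set.indicator_of_mem h1, mul_assoc,
          ofReal_rpow_mul_ofReal_rpow ht]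
        ring_nf
      · rw [Set.indicator_of_notMem h1, Set.indicator_of_notMem h1, zero_mul]
    rw [setLIntegral_congr_fun measurableSet_Ioi e, lintegral_indicator measurableSet_Iic,
      Measure.restrict_restrict measurableSet_Iic, Set.inter_comm, Set.Ioi_inter_Iic,
      lintegral_const_mul _ (by fun_prop), lintegral_Ioc_zero_one_rpow (by linarith),
      ← ENNReal.ofReal_mul (by positivity), ← ENNReal.ofReal_mul (by positivity)]
    refine ENNReal.ofReal_le_ofReal (le_of_eq ?_)
    rw [show a - p - 1 + 1 = a - p by ring]
    ring

/-- Inside a disc, the integral of `(ρ / |z|) ^ a` is at most the mass of the disc plus the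
contribution of the smaller discs of radius `ρ / t`, `t > 1`; the set `S` collects the `t` for
which that disc may carry mass. -/
lemma HasPowerGrowth.lintegral_inside_le_add {n : Measure ℂ} {A p ρ a : ℝ}
    (h : HasPowerGrowth n A p) (hρ : 0 < ρ) (ha : 0 < a)
    {S : Set ℝ} (hS : MeasurableSet S) (h1S : S ⊆ Set.Ioi 1)
    (hn : ∀ t, 1 < t → t ∉ S → n (Metric.closedBall 0 (ρ / t)) = 0) :
    ∫⁻ z in Metric.ball 0 ρ, ENNReal.ofReal ((ρ / ‖z‖) ^ a) ∂n ≤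
      ENNReal.ofReal (A * ρ ^ p) * (1 + ENNReal.ofReal a *
        ∫⁻ t in S, ENNReal.ofReal (t ^ (a - p - 1))) := by
  refine (lintegral_div_norm_rpow_le _ hρ ha (g := fun t => ENNReal.ofReal (A * ρ ^ p) *
    ((Set.Iic 1).indicator (fun _ => 1) t + S.indicator (fun t => ENNReal.ofReal (t ^ (-p))) t))
    fun t ht => ?_).trans ?_
  · by_cases h1 : t ≤ 1
    · rw [Set.indicator_of_mem (Set.mem_Iic.2 h1), mul_add, mul_one]
      refine le_add_right ?_
      calc _ ≤ (n.restrict (Metric.ball 0 ρ)) Set.univ := measure_mono (Set.subset_univ _)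
        _ ≤ n (Metric.closedBall 0 ρ) := by
          rw [Measure.restrict_apply_univ]
          exact measure_mono Metric.ball_subset_closedBall
        _ ≤ _ := h ρ hρ.le
    · refine (Measure.restrict_apply_le _ _).trans ?_
      by_cases hS' : t ∈ S
      · rw [Set.indicator_of_mem hS', mul_add]
        exact le_add_left (h.measure_le_div_norm hρ ht)
      · rw [measure_mono_null (le_div_norm_subset ht) (hn t (not_le.1 h1) hS')]
        exact zero_le
  · have e : ∀ t ∈ Set.Ioi (0 : ℝ), ENNReal.ofReal (A * ρ ^ p) *
        ((Set.Iic 1).indicator (fun _ => 1) t +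
          S.indicator (fun t => ENNReal.ofReal (t ^ (-p))) t) * ENNReal.ofReal (t ^ (a - 1)) =
        ENNReal.ofReal (A * ρ ^ p) *
        ((Set.Iic 1).indicator (fun t => ENNReal.ofReal (t ^ (a - 1))) t +
          S.indicator (fun t => ENNReal.ofReal (t ^ (a - p - 1))) t) := by
      intro t ht
      rw [mul_assoc, add_mul]
      congr 2
      · by_cases h1 : t ∈ Set.Iic (1 : ℝ) <;> simp [h1]
      · by_cases h1 : t ∈ S
        · rw [Set.indicator_of_mem h1, Set.indicator_of_mem h1, ofReal_rpow_mul_ofReal_rpow ht]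
          ring_nf
        · simp [h1]
    have hS0 : S ∩ Set.Ioi 0 = S :=
      Set.inter_eq_left.2 fun t ht => Set.mem_Ioi.2 (zero_lt_one.trans (h1S ht))
    rw [setLIntegral_congr_fun measurableSet_Ioi e,
      lintegral_const_mul _ (by
        refine Measurable.add (Measurable.indicator (by fun_prop) measurableSet_Iic)
          (Measurable.indicator (by fun_prop) hS)),
      lintegral_add_left (Measurable.indicator (by fun_prop) measurableSet_Iic),
      lintegral_indicator measurableSet_Iic, lintegral_indicator hS,
      Measure.restrict_restrict measurableSet_Iic, Measure.restrict_restrict hS, hS0,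
      Set.inter_comm, Set.Ioi_inter_Iic, lintegral_Ioc_zero_one_rpow (by linarith),
      mul_left_comm, mul_add, ← ENNReal.ofReal_mul ha.le, sub_add_cancel,
      mul_one_div_cancel ha.ne', ENNReal.ofReal_one]

/-- Inside a disc, `(ρ / |z|) ^ a` integrates to `O(ρ ^ p)` when `a` is below the order of
growth. -/
lemma HasPowerGrowth.lintegral_inside_le {n : Measure ℂ} {A p ρ a : ℝ}
    (h : HasPowerGrowth n A p) (hA : 0 ≤ A) (hρ : 0 < ρ) (ha : 0 ≤ a) (hap : a = 0 ∨ a < p) :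
    ∫⁻ z in Metric.ball 0 ρ, ENNReal.ofReal ((ρ / ‖z‖) ^ a) ∂n ≤
      ENNReal.ofReal ((1 + a / (p - a)) * A * ρ ^ p) := by
  rcases ha.eq_or_lt with rfl | ha0
  · simp only [Real.rpow_zero, ENNReal.ofReal_one, lintegral_one, Measure.restrict_apply_univ,
      zero_div, add_zero, one_mul]
    exact (measure_mono Metric.ball_subset_closedBall).trans (h ρ hρ.le)
  · have hlt : a < p := hap.resolve_left ha0.ne'
    refine (h.lintegral_inside_le_add hρ ha0 (S := Set.Ioi 1) measurableSet_Ioi le_rfl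
      (fun t h1 h2 => absurd h1 h2)).trans (le_of_eq ?_)
    have hd : 0 < p - a := by linarith
    rw [lintegral_Ioi_one_rpow (by linarith), ← ENNReal.ofReal_mul ha, ← ENNReal.ofReal_one,
      show -1 / (a - p - 1 + 1) = 1 / (p - a) by
        rw [show a - p - 1 + 1 = -(p - a) by ring, neg_div_neg_eq],
      ← ENNReal.ofReal_add zero_le_one (by positivity), ← ENNReal.ofReal_mul (by positivity)]
    congr 1
    ring

/-- At the critical exponent the integral over a disc picks up a logarithm. -/
lemma HasPowerGrowth.lintegral_inside_le_log {n : Measure ℂ} {A p ρ r₀ : ℝ}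
    (h : HasPowerGrowth n A p) (hA : 0 ≤ A) (hp : 0 < p) (hr₀ : 0 < r₀) (hρ : 0 < ρ)
    (hn : n (Metric.ball 0 r₀) = 0) :
    ∫⁻ z in Metric.ball 0 ρ, ENNReal.ofReal ((ρ / ‖z‖) ^ p) ∂n ≤
      ENNReal.ofReal ((1 + p * Real.log (1 + ρ / r₀)) * A * ρ ^ p) := by
  have hc : 1 ≤ 1 + ρ / r₀ := le_add_of_nonneg_right (by positivity)
  refine (h.lintegral_inside_le_add hρ hp (S := Set.Ioc 1 (1 + ρ / r₀)) measurableSet_Ioc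
    (fun t ht => ht.1) fun t h1 h2 => ?_).trans (le_of_eq ?_)
  · refine measure_mono_null (Metric.closedBall_subset_ball ?_) hn
    have ht : ρ / r₀ < t := by
      by_contra! h3
      exact h2 ⟨h1, h3.trans (by linarith)⟩
    rw [div_lt_iff₀ hr₀] at ht
    rw [div_lt_iff₀ (by linarith)]
    linarith
  · have hl := Real.log_nonneg hc
    rw [show p - p - 1 = (-1 : ℝ) by ring, lintegral_Ioc_one_inv hc, ← ENNReal.ofReal_mul hp.le,
      ← ENNReal.ofReal_one, ← ENNReal.ofReal_add zero_le_one (by positivity),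
      ← ENNReal.ofReal_mul (by positivity)]
    congr 1
    ring

/-! ### Charges: construction, uniqueness and bounds -/

namespace Charge

/-- The Jordan decomposition of the difference of two locally finite measures. -/
lemma exists_value_eq_sub (l₁ l₂ : Measure ℂ) [IsLocallyFiniteMeasure l₁]
    [IsLocallyFiniteMeasure l₂] :
    ∃ μ : Charge, ∀ B : Set ℂ, Bornology.IsBounded B → μ.value B = l₁.real B - l₂.real B := by
  set l := l₁ + l₂ with hl
  have hf₁ : l.withDensity (l₁.rnDeriv l) = l₁ :=
    Measure.withDensity_rnDeriv_eq _ _ (Measure.le_add_right le_rfl).absolutelyContinuous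
  have hf₂ : l.withDensity (l₂.rnDeriv l) = l₂ :=
    Measure.withDensity_rnDeriv_eq _ _ (Measure.le_add_left le_rfl).absolutelyContinuous
  have hm₁ := Measure.measurable_rnDeriv l₁ l
  have hm₂ := Measure.measurable_rnDeriv l₂ l
  generalize l₁.rnDeriv l = f₁ at *
  generalize l₂.rnDeriv l = f₂ at *
  have hp : l.withDensity (f₁ - f₂) ≤ l₁ := by
    conv_rhs => rw [← hf₁]
    exact withDensity_mono (Eventually.of_forall fun z => tsub_le_self)
  have hn : l.withDensity (f₂ - f₁) ≤ l₂ := by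
    conv_rhs => rw [← hf₂]
    exact withDensity_mono (Eventually.of_forall fun z => tsub_le_self)
  have hadd : l.withDensity (f₁ - f₂) + l₂ = l.withDensity (f₂ - f₁) + l₁ := by
    conv_lhs => rw [← hf₂]
    conv_rhs => rw [← hf₁]
    rw [← withDensity_add_left (hm₁.sub hm₂), ← withDensity_add_left (hm₂.sub hm₁)]
    congr 1
    ext z
    simp only [Pi.add_apply, Pi.sub_apply, tsub_add_eq_max, max_comm]
  have hpl : IsLocallyFiniteMeasure (l.withDensity (f₁ - f₂)) :=
    Measure.isLocallyFiniteMeasure_of_le hp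
  have hnl : IsLocallyFiniteMeasure (l.withDensity (f₂ - f₁)) :=
    Measure.isLocallyFiniteMeasure_of_le hn
  refine ⟨⟨l.withDensity (f₁ - f₂), l.withDensity (f₂ - f₁), hpl, hnl,
    {z | f₁ z ≤ f₂ z}, measurableSet_le hm₁ hm₂, ?_, ?_⟩, fun B hB => ?_⟩
  -- both densities are truncated differences, so they vanish on complementary sets
  · rw [withDensity_apply _ (measurableSet_le hm₁ hm₂)]
    exact setLIntegral_eq_zero (measurableSet_le hm₁ hm₂) fun z hz => tsub_eq_zero_of_le hz
  · rw [withDensity_apply _ (measurableSet_le hm₁ hm₂).compl]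
    exact setLIntegral_eq_zero (measurableSet_le hm₁ hm₂).compl
      fun z hz => tsub_eq_zero_of_le (le_of_not_ge hz)
  · have h : (l.withDensity (f₁ - f₂) + l₂).real B = (l.withDensity (f₂ - f₁) + l₁).real B := by
      rw [hadd]
    rw [measureReal_add_apply hB.measure_lt_top.ne hB.measure_lt_top.ne,
      measureReal_add_apply hB.measure_lt_top.ne hB.measure_lt_top.ne] at h
    change (l.withDensity (f₁ - f₂)).real B - (l.withDensity (f₂ - f₁)).real B = _
    linarith

/-- There is a Borel set carrying the upper variation on which the charge equals it, and off which
the charge is the negative of the lower variation. -/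
lemma exists_hahn_set (μ : Charge) : ∃ P : Set ℂ, MeasurableSet P ∧
    (∀ B, μ.value (B ∩ P) = μ.pos.real B) ∧ ∀ B, μ.value (B ∩ Pᶜ) = -μ.neg.real B := by
  obtain ⟨S, hS, h1, h2⟩ := μ.mutuallySingular
  have hi : ∀ (m : Measure ℂ) (B T : Set ℂ), m T = 0 → m.real (B ∩ Tᶜ) = m.real B := by
    intro m B T hT
    refine measureReal_congr (inter_ae_eq_left_of_ae_eq_univ (ae_eq_univ.2 ?_))
    rwa [compl_compl]
  have hz : ∀ (m : Measure ℂ) (B T : Set ℂ), m T = 0 → m.real (B ∩ T) = 0 := fun m B T hT => by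
    rw [Measure.real, measure_mono_null Set.inter_subset_right hT, ENNReal.toReal_zero]
  refine ⟨Sᶜ, hS.compl, fun B => ?_, fun B => ?_⟩
  · rw [value, hi _ _ _ h1, hz _ _ _ h2, sub_zero]
  · rw [value, compl_compl, hz _ _ _ h1]
    have := hi μ.neg B Sᶜ h2
    rw [compl_compl] at this
    rw [this, zero_sub]

lemma pos_real_le_of_value_eq {μ μ' : Charge}
    (h : ∀ B, MeasurableSet B → Bornology.IsBounded B → μ.value B = μ'.value B) {B : Set ℂ}
    (hB : MeasurableSet B) (hb : Bornology.IsBounded B) : μ.pos.real B ≤ μ'.pos.real B := by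
  obtain ⟨P, hP, h1, -⟩ := μ.exists_hahn_set
  rw [← h1, h _ (hB.inter hP) (hb.subset Set.inter_subset_left), value]
  have h2 : μ'.pos.real (B ∩ P) ≤ μ'.pos.real B :=
    measureReal_mono Set.inter_subset_left hb.measure_lt_top.ne
  have h3 : 0 ≤ μ'.neg.real (B ∩ P) := measureReal_nonneg
  linarith

lemma _root_.MeasureTheory.Measure.eq_of_real_eq_of_isBounded {m m' : Measure ℂ}
    [IsLocallyFiniteMeasure m] [IsLocallyFiniteMeasure m']
    (h : ∀ B, MeasurableSet B → Bornology.IsBounded B → m.real B = m'.real B) : m = m' := by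
  ext B hB
  have hmono : Monotone fun n : ℕ => B ∩ Metric.closedBall 0 (n : ℝ) := fun i j hij =>
    Set.inter_subset_inter_right _ (Metric.closedBall_subset_closedBall (by exact_mod_cast hij))
  have hU : ⋃ n : ℕ, B ∩ Metric.closedBall 0 (n : ℝ) = B := by
    rw [← Set.inter_iUnion, Metric.iUnion_closedBall_nat, Set.inter_univ]
  rw [← hU, hmono.measure_iUnion, hmono.measure_iUnion]
  congr 1
  ext n
  have hb : Bornology.IsBounded (B ∩ Metric.closedBall 0 (n : ℝ)) :=
    Metric.isBounded_closedBall.subset Set.inter_subset_right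
  exact (measureReal_eq_measureReal_iff hb.measure_lt_top.ne hb.measure_lt_top.ne).1
    (h _ (hB.inter measurableSet_closedBall) hb)

/-- A charge is determined by its values on bounded Borel sets. -/
lemma ext_of_value {μ μ' : Charge}
    (h : ∀ B, MeasurableSet B → Bornology.IsBounded B → μ.value B = μ'.value B) : μ = μ' := by
  have hpos : ∀ B, MeasurableSet B → Bornology.IsBounded B → μ.pos.real B = μ'.pos.real B :=
    fun B hB hb => (pos_real_le_of_value_eq h hB hb).antisymm
      (pos_real_le_of_value_eq (fun B hB hb => (h B hB hb).symm) hB hb)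
  have hneg : ∀ B, MeasurableSet B → Bornology.IsBounded B → μ.neg.real B = μ'.neg.real B := by
    intro B hB hb
    have h1 := h B hB hb
    have h2 := hpos B hB hb
    simp only [value] at h1
    linarith
  exact Charge.ext (Measure.eq_of_real_eq_of_isBounded hpos)
    (Measure.eq_of_real_eq_of_isBounded hneg)

lemma radTV_eq (μ : Charge) (r : ℝ) : μ.radTV r =
    μ.pos.real (Metric.closedBall 0 r) + μ.neg.real (Metric.closedBall 0 r) :=
  measureReal_add_apply measure_closedBall_lt_top.ne measure_closedBall_lt_top.ne

lemma radTV_le_of_abs_value_le (μ : Charge) {r M : ℝ}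
    (h : ∀ B, MeasurableSet B → B ⊆ Metric.closedBall 0 r → |μ.value B| ≤ M) :
    μ.radTV r ≤ 2 * M := by
  obtain ⟨P, hP, h1, h2⟩ := μ.exists_hahn_set
  have h3 := h _ (measurableSet_closedBall.inter hP) Set.inter_subset_left
  have h4 := h _ (measurableSet_closedBall.inter hP.compl) Set.inter_subset_left
  rw [h1] at h3
  rw [h2, abs_neg] at h4
  rw [radTV_eq]
  linarith [le_abs_self (μ.pos.real (Metric.closedBall 0 r)),
    le_abs_self (μ.neg.real (Metric.closedBall 0 r))]

lemma tv_closedBall_lt_top (μ : Charge) (r : ℝ) : μ.tv (Metric.closedBall 0 r) < ⊤ := by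
  rw [tv, Measure.add_apply]
  exact ENNReal.add_lt_top.2 ⟨measure_closedBall_lt_top, measure_closedBall_lt_top⟩

lemma radTV_mono (μ : Charge) {r r' : ℝ} (h : r ≤ r') : μ.radTV r ≤ μ.radTV r' :=
  measureReal_mono (Metric.closedBall_subset_closedBall h) (μ.tv_closedBall_lt_top r').ne

lemma finiteType_of_radTV_le (μ : Charge) {p C : ℝ}
    (h : ∀ᶠ r in atTop, μ.radTV r ≤ C * r ^ p) : μ.FiniteType p := by
  refine lt_of_le_of_lt (b := ENNReal.ofReal C) (limsup_le_of_le (by isBoundedDefault) ?_)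
    ENNReal.ofReal_lt_top
  filter_upwards [h, eventually_gt_atTop 0] with r hr hr0
  have hrp : 0 < r ^ p := Real.rpow_pos_of_pos hr0 p
  refine ENNReal.div_le_of_le_mul ?_
  rw [← ENNReal.ofReal_mul' hrp.le,
    ← ENNReal.ofReal_toReal (μ.tv_closedBall_lt_top r).ne]
  exact ENNReal.ofReal_le_ofReal hr

lemma exists_ball_null (ν : Charge) (h0 : (0 : ℂ) ∉ ν.support) :
    ∃ r₀ > 0, ν.tv (Metric.ball 0 r₀) = 0 := by
  obtain ⟨U, hU, hU0⟩ := Measure.notMem_support_iff_exists.1 h0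
  obtain ⟨r₀, hr₀, hsub⟩ := Metric.mem_nhds_iff.1 hU
  exact ⟨r₀, hr₀, measure_mono_null hsub hU0⟩

lemma tv_ball_eq_zero (ν : Charge) {r₀ : ℝ} (h : Metric.ball 0 r₀ ∩ ν.support = ∅) :
    ν.tv (Metric.ball 0 r₀) = 0 := by
  refine measure_mono_null ?_ (Measure.measure_compl_support (μ := ν.tv))
  exact fun z hz hz' => (Set.eq_empty_iff_forall_notMem.1 h z) ⟨hz, hz'⟩

/-- Near the origin there is no mass, so finite type gives the growth bound for all radii. -/
lemma exists_hasPowerGrowth (ν : Charge) {p : ℝ} (hp : 0 ≤ p) (hν : ν.FiniteType p)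
    (h0 : (0 : ℂ) ∉ ν.support) : ∃ A : ℝ, 0 ≤ A ∧ HasPowerGrowth ν.tv A p := by
  obtain ⟨r₀, hr₀, hn⟩ := ν.exists_ball_null h0
  obtain ⟨c, hc, hct⟩ := exists_between hν
  have hev := eventually_lt_of_limsup_lt hc (by isBoundedDefault)
  obtain ⟨r₁, hr₁⟩ := eventually_atTop.1 (hev.and (eventually_gt_atTop 0))
  have hr₀p : 0 < r₀ ^ p := Real.rpow_pos_of_pos hr₀ p
  refine ⟨c.toReal + ν.radTV r₁ / r₀ ^ p, add_nonneg ENNReal.toReal_nonneg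
    (div_nonneg measureReal_nonneg hr₀p.le), fun r hr => ?_⟩
  have hV : 0 ≤ ν.radTV r₁ := measureReal_nonneg
  have hrp : 0 ≤ r ^ p := Real.rpow_nonneg hr p
  rcases lt_or_ge r r₀ with h | h
  · rw [measure_mono_null (Metric.closedBall_subset_ball h) hn]
    exact zero_le
  rw [← ENNReal.ofReal_toReal (ν.tv_closedBall_lt_top r).ne]
  refine ENNReal.ofReal_le_ofReal ?_
  rw [add_mul]
  rcases le_total r r₁ with h' | h'
  · have h1 : ν.radTV r ≤ ν.radTV r₁ := ν.radTV_mono h'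
    have h2 : ν.radTV r₁ ≤ ν.radTV r₁ / r₀ ^ p * r ^ p := by
      rw [div_mul_eq_mul_div, le_div_iff₀ hr₀p]
      exact mul_le_mul_of_nonneg_left (Real.rpow_le_rpow hr₀.le h hp) hV
    have h3 : 0 ≤ c.toReal * r ^ p := mul_nonneg ENNReal.toReal_nonneg hrp
    change ν.radTV r ≤ _
    linarith
  · obtain ⟨h1, h2⟩ := hr₁ r h'
    have hrp' : 0 < r ^ p := Real.rpow_pos_of_pos h2 p
    have h3 : ν.tv (Metric.closedBall 0 r) ≤ c * ENNReal.ofReal (r ^ p) :=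
      (ENNReal.div_le_iff (by simpa using hrp') ENNReal.ofReal_ne_top).1 h1.le
    have h4 := ENNReal.toReal_mono (ENNReal.mul_ne_top hct.ne ENNReal.ofReal_ne_top) h3
    rw [ENNReal.toReal_mul, ENNReal.toReal_ofReal hrp] at h4
    have h5 : 0 ≤ ν.radTV r₁ / r₀ ^ p * r ^ p := by positivity
    linarith

end Charge

/-! ### Geometry of the angle -/

lemma norm_anglePow (α s : ℝ) (z : ℂ) : ‖anglePow α s z‖ = ‖z‖ ^ s := by
  rw [anglePow, norm_mul, Complex.norm_exp_ofReal_mul_I, mul_one, Complex.norm_real,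
    Real.norm_eq_abs, abs_of_nonneg (by positivity)]

lemma anglePow_pow (α s : ℝ) (q : ℕ) (z : ℂ) : anglePow α s z ^ q = anglePow α (s * q) z := by
  rw [anglePow, anglePow, mul_pow, ← Complex.exp_nat_mul, Real.rpow_mul (norm_nonneg z),
    Real.rpow_natCast]
  push_cast
  congr 2
  ring

lemma measurable_argFrom (α : ℝ) : Measurable (argFrom α) := by
  unfold argFrom
  fun_prop

lemma measurable_anglePow (α s : ℝ) : Measurable (anglePow α s) := by
  have := measurable_argFrom α
  unfold anglePow
  fun_prop

lemma argFrom_ofReal_mul_exp {α ρ θ : ℝ} (hρ : 0 < ρ) (h1 : α < θ) (h2 : θ < α + 2 * Real.pi) :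
    argFrom α ((ρ : ℂ) * Complex.exp ((θ : ℂ) * Complex.I)) = θ - α := by
  have : -((ρ : ℂ) * Complex.exp ((θ : ℂ) * Complex.I) *
      Complex.exp (-(α : ℂ) * Complex.I)) =
      (ρ : ℂ) * Complex.exp (((θ - α - Real.pi : ℝ) : ℂ) * Complex.I) := by
    rw [mul_assoc, ← Complex.exp_add, ← mul_neg]
    congr 1
    rw [show (((θ - α - Real.pi : ℝ) : ℂ) * Complex.I) =
      ((θ : ℂ) * Complex.I + -(α : ℂ) * Complex.I) - Real.pi * Complex.I by push_cast; ring,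
      Complex.exp_sub, Complex.exp_pi_mul_I, div_neg, div_one]
  rw [argFrom, this, Complex.exp_mul_I, ← Complex.ofReal_cos, ← Complex.ofReal_sin]
  have h := Complex.arg_mul_cos_add_sin_mul_I hρ
    (θ := θ - α - Real.pi) ⟨by linarith, by linarith⟩
  push_cast at h ⊢
  rw [h]
  ring

lemma mem_openAngle_iff {α β : ℝ} (hβ : β ≤ α + 2 * Real.pi) {z : ℂ} :
    z ∈ openAngle α β ↔ z ≠ 0 ∧ 0 < argFrom α z ∧ argFrom α z < β - α := by
  constructor
  · rintro ⟨ρ, θ, hρ, h1, h2, rfl⟩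
    rw [argFrom_ofReal_mul_exp hρ h1 (by linarith)]
    refine ⟨mul_ne_zero (by exact_mod_cast hρ.ne') (Complex.exp_ne_zero _), by linarith,
      by linarith⟩
  · rintro ⟨h0, h1, h2⟩
    refine ⟨‖z‖, α + argFrom α z, norm_pos_iff.2 h0, by linarith, by linarith, ?_⟩
    have h := Complex.norm_mul_exp_arg_mul_I (-(z * Complex.exp (-(α : ℂ) * Complex.I)))
    rw [norm_neg, norm_mul, ← Complex.ofReal_neg, Complex.norm_exp_ofReal_mul_I, mul_one] at h
    rw [argFrom, show ((α + (Complex.arg (-(z * Complex.exp (-(α : ℂ) * Complex.I))) +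
      Real.pi) : ℝ) : ℂ) * Complex.I =
      (Complex.arg (-(z * Complex.exp (((-α : ℝ) : ℂ) * Complex.I)))) * Complex.I +
        (α * Complex.I + Real.pi * Complex.I) by push_cast; ring,
      Complex.exp_add, ← mul_assoc, h, Complex.exp_add, Complex.exp_pi_mul_I]
    have : Complex.exp (((-α : ℝ) : ℂ) * Complex.I) * Complex.exp (α * Complex.I) = 1 := by
      rw [← Complex.exp_add]
      simp
    linear_combination (-z) * this

lemma measurableSet_openAngle {α β : ℝ} (hβ : β ≤ α + 2 * Real.pi) :
    MeasurableSet (openAngle α β) := by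
  have : openAngle α β = {z | z ≠ 0 ∧ 0 < argFrom α z ∧ argFrom α z < β - α} :=
    Set.ext fun z => mem_openAngle_iff hβ
  rw [this]
  have := measurable_argFrom α
  measurability

lemma norm_angleMap (α β : ℝ) (z : ℂ) : ‖angleMap α β z‖ = ‖z‖ ^ (Real.pi / (β - α)) :=
  norm_anglePow _ _ _

lemma angleMap_pow (α β : ℝ) (q : ℕ) (z : ℂ) :
    angleMap α β z ^ q = anglePow α (Real.pi * q / (β - α)) z := by
  rw [angleMap, anglePow_pow]
  congr 1
  ring

lemma im_angleMap_pos {α β : ℝ} (hαβ : α < β) (hβ : β ≤ α + 2 * Real.pi) {z : ℂ}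
    (hz : z ∈ openAngle α β) : 0 < (angleMap α β z).im := by
  obtain ⟨h0, h1, h2⟩ := (mem_openAngle_iff hβ).1 hz
  have hd : 0 < β - α := sub_pos.2 hαβ
  rw [angleMap, anglePow, Complex.im_ofReal_mul, Complex.exp_ofReal_mul_I_im]
  refine mul_pos (Real.rpow_pos_of_pos (norm_pos_iff.2 h0) _)
    (Real.sin_pos_of_pos_of_lt_pi (mul_pos (div_pos Real.pi_pos hd) h1) ?_)
  rw [div_mul_eq_mul_div, div_lt_iff₀ hd]
  exact mul_lt_mul_of_pos_left h2 Real.pi_pos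

lemma measurable_angleMap (α β : ℝ) : Measurable (angleMap α β) := measurable_anglePow _ _

lemma measurable_angleBoundary (α β : ℝ) : Measurable (angleBoundary α β) := by
  have : Measurable fun t : ℝ => (if 0 ≤ t then α else β : ℝ) :=
    Measurable.ite measurableSet_Ici measurable_const measurable_const
  unfold angleBoundary
  fun_prop

lemma norm_angleBoundary (α β t : ℝ) :
    ‖angleBoundary α β t‖ = |t| ^ ((β - α) / Real.pi) := by
  rw [angleBoundary, norm_mul, Complex.norm_exp_ofReal_mul_I, mul_one, Complex.norm_real,
    Real.norm_eq_abs, abs_of_nonneg (by positivity)]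

lemma preimage_angleBoundary_subset {α β r : ℝ} (hαβ : α < β) (hr : 0 ≤ r) {B : Set ℂ}
    (hB : B ⊆ Metric.closedBall 0 r) :
    angleBoundary α β ⁻¹' B ⊆
      Set.Icc (-(r ^ (Real.pi / (β - α)))) (r ^ (Real.pi / (β - α))) := by
  intro t ht
  have hd : 0 < β - α := sub_pos.2 hαβ
  have h := mem_closedBall_zero_iff.1 (hB ht)
  rw [norm_angleBoundary] at h
  rw [Set.mem_Icc, ← abs_le, ← inv_div]
  exact (Real.le_rpow_inv_iff_of_pos (abs_nonneg t) hr (div_pos hd Real.pi_pos)).2 h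

/-! ### The majorant of the harmonic charge and its integrals -/

lemma powerWeight_nonneg (a b : ℕ) {x : ℝ} (hx : 0 ≤ x) : 0 ≤ powerWeight a b x := by
  unfold powerWeight
  split_ifs <;> positivity

lemma measurable_powerWeight (a b : ℕ) : Measurable (powerWeight a b) :=
  Measurable.ite measurableSet_Ioi (by fun_prop) (by fun_prop)

lemma lintegral_powerWeight_le_add (n : Measure ℂ) {s r : ℝ} (hs : 0 < s) (hr : 0 < r)
    (a : ℕ) {b : ℕ} (hb : b ≠ 0) :
    ∫⁻ z, ENNReal.ofReal (powerWeight a b ((r / ‖z‖) ^ s)) ∂n ≤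
      (∫⁻ z in Metric.ball 0 r, ENNReal.ofReal ((r / ‖z‖) ^ (s * a)) ∂n) +
        ∫⁻ z in (Metric.ball 0 r)ᶜ, ENNReal.ofReal ((r / ‖z‖) ^ (s * b)) ∂n := by
  rw [← lintegral_add_compl _ (measurableSet_ball (x := (0 : ℂ)) (ε := r))]
  have hx (z : ℂ) : 0 ≤ r / ‖z‖ := by positivity
  refine add_le_add (setLIntegral_mono' measurableSet_ball fun z hz => ?_)
    (setLIntegral_mono' measurableSet_ball.compl fun z hz => ?_)
  · refine ENNReal.ofReal_le_ofReal ?_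
    rw [Real.rpow_mul (hx z), Real.rpow_natCast]
    rcases (norm_nonneg z).eq_or_lt with h | h
    · -- at the origin both sides are powers of the junk value `r / 0 = 0`
      rw [← h, div_zero, Real.zero_rpow hs.ne', powerWeight, if_neg (by norm_num)]
      rw [zero_pow hb]
      positivity
    · have h1 : 1 < r / ‖z‖ := (one_lt_div h).2 (mem_ball_zero_iff.1 hz)
      rw [powerWeight, if_pos (Real.one_lt_rpow h1 hs)]
  · refine ENNReal.ofReal_le_ofReal ?_
    rw [Real.rpow_mul (hx z), Real.rpow_natCast]
    have h1 : r / ‖z‖ ≤ 1 :=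
      div_le_one_of_le₀ (by simpa using hz) (norm_nonneg z)
    rw [powerWeight, if_neg (not_lt.2 (Real.rpow_le_one (hx z) h1 hs.le))]

/-- Off the critical exponent the majorant integrates to `O(r ^ p)`. -/
lemma HasPowerGrowth.exists_lintegral_powerWeight_le {n : Measure ℂ} {A p s : ℝ}
    (h : HasPowerGrowth n A p) (hA : 0 ≤ A) (hp : 0 ≤ p) (hs : 0 < s) {a b : ℕ}
    (ha : s * a = 0 ∨ s * a < p) (hb : p < s * b) :
    ∃ C : ℝ, 0 ≤ C ∧ ∀ r : ℝ, 0 < r →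
      ∫⁻ z, ENNReal.ofReal (powerWeight a b ((r / ‖z‖) ^ s)) ∂n ≤
        ENNReal.ofReal (C * r ^ p) := by
  have hb0 : b ≠ 0 := by
    rintro rfl
    simp at hb
    linarith
  have hsa : 0 ≤ s * a := by positivity
  have h1 : 0 ≤ 1 + s * a / (p - s * a) := by
    rcases ha with h0 | h0
    · rw [h0]; norm_num
    · have : 0 < p - s * a := by linarith
      positivity
  have h2 : 0 ≤ s * b / (s * b - p) := by
    have : 0 < s * b - p := by linarith
    positivity
  refine ⟨(1 + s * a / (p - s * a)) * A + s * b / (s * b - p) * A, by positivity,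
    fun r hr => ?_⟩
  refine (lintegral_powerWeight_le_add n hs hr a hb0).trans ?_
  rw [add_mul, ENNReal.ofReal_add (by positivity) (by positivity)]
  exact add_le_add (h.lintegral_inside_le hA hr hsa ha) (h.lintegral_outside_le hA hp hr hb)

/-- At the critical exponent a logarithm appears. -/
lemma HasPowerGrowth.exists_lintegral_powerWeight_le_log {n : Measure ℂ} {A p s r₀ : ℝ}
    (h : HasPowerGrowth n A p) (hA : 0 ≤ A) (hp : 0 ≤ p) (hs : 0 < s) {a b : ℕ}
    (ha : s * a ≤ p) (hb : p < s * b) (hr₀ : 0 < r₀) (hn : n (Metric.ball 0 r₀) = 0) :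
    ∃ C : ℝ, 0 ≤ C ∧ ∀ r : ℝ, 0 < r →
      ∫⁻ z, ENNReal.ofReal (powerWeight a b ((r / ‖z‖) ^ s)) ∂n ≤
        ENNReal.ofReal (C * r ^ p * (1 + Real.log (1 + r / r₀))) := by
  have hlog (r : ℝ) (hr : 0 < r) : 0 ≤ Real.log (1 + r / r₀) :=
    Real.log_nonneg (le_add_of_nonneg_right (by positivity))
  rcases ha.lt_or_eq with ha' | ha'
  · obtain ⟨C, hC, hC'⟩ := h.exists_lintegral_powerWeight_le hA hp hs (Or.inr ha') hb
    refine ⟨C, hC, fun r hr => (hC' r hr).trans (ENNReal.ofReal_le_ofReal ?_)⟩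
    have := hlog r hr
    exact le_mul_of_one_le_right (by positivity) (by linarith)
  rcases hp.eq_or_lt with hp0 | hp0
  · obtain ⟨C, hC, hC'⟩ := h.exists_lintegral_powerWeight_le hA hp hs
      (Or.inl (ha'.trans hp0.symm)) hb
    refine ⟨C, hC, fun r hr => (hC' r hr).trans (ENNReal.ofReal_le_ofReal ?_)⟩
    have := hlog r hr
    exact le_mul_of_one_le_right (by positivity) (by linarith)
  have hb0 : b ≠ 0 := by
    rintro rfl
    simp at hb
    linarith
  have h2 : 0 ≤ s * b / (s * b - p) := by
    have : 0 < s * b - p := by linarith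
    positivity
  refine ⟨(1 + p) * A + s * b / (s * b - p) * A, by positivity, fun r hr => ?_⟩
  refine (lintegral_powerWeight_le_add n hs hr a hb0).trans ?_
  have h3 := h.lintegral_inside_le_log hA hp0 hr₀ hr hn
  rw [ha']
  refine (add_le_add h3 (h.lintegral_outside_le hA hp hr hb)).trans ?_
  have hl := hlog r hr
  have hrp : 0 < r ^ p := Real.rpow_pos_of_pos hr p
  rw [← ENNReal.ofReal_add (by positivity) (by positivity)]
  refine ENNReal.ofReal_le_ofReal ?_
  generalize Real.log (1 + r / r₀) = l at *
  generalize s * b / (s * b - p) = d at *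
  have e1 : 0 ≤ A * r ^ p := by positivity
  have e2 : 0 ≤ l * (A * r ^ p) := by positivity
  have e3 : 0 ≤ p * (A * r ^ p) := by positivity
  have e4 : 0 ≤ d * l * (A * r ^ p) := by positivity
  nlinarith

/-- The constant in the bound of the genus-`q` kernel by its majorant. -/
noncomputable def genusConst (q : ℕ) : ℝ := (Real.pi + 2 * q) * 2 ^ (q + 1)

lemma genusConst_nonneg (q : ℕ) : 0 ≤ genusConst q := by
  unfold genusConst
  positivity

lemma isBounded_preimage_angleBoundary {α β r : ℝ} (hαβ : α < β) (hr : 0 < r) {B : Set ℂ}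
    (hB : B ⊆ Metric.closedBall 0 r) : Bornology.IsBounded (angleBoundary α β ⁻¹' B) :=
  (Metric.isBounded_Icc _ _).subset (preimage_angleBoundary_subset hαβ hr.le hB)

lemma setIntegral_abs_genusKernel_le (q : ℕ) {α β r : ℝ} (hαβ : α < β)
    (hβ : β ≤ α + 2 * Real.pi) (hr : 0 < r) {B : Set ℂ} (hB : B ⊆ Metric.closedBall 0 r)
    {z : ℂ} (hz : z ∈ openAngle α β) :
    ∫ t in angleBoundary α β ⁻¹' B, |genusKernel q (angleMap α β z) t| ≤
      genusConst q * powerWeight q (q + 1) ((r / ‖z‖) ^ (Real.pi / (β - α))) := by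
  have hw := im_angleMap_pos hαβ hβ hz
  have h := integral_abs_genusKernel_le q hw (Real.rpow_pos_of_pos hr (Real.pi / (β - α)))
  rw [norm_angleMap, ← Real.div_rpow hr.le (norm_nonneg z)] at h
  refine le_trans (setIntegral_mono_set ?_ (Eventually.of_forall fun t => abs_nonneg _)
    (preimage_angleBoundary_subset hαβ hr.le hB).eventuallyLE) h
  exact (integrableOn_genusKernel q hw (Metric.isBounded_Icc _ _)).abs

lemma abs_harmonicChargeAngle_le (q : ℕ) {α β r : ℝ} (hαβ : α < β)
    (hβ : β ≤ α + 2 * Real.pi) (hr : 0 < r) {B : Set ℂ} (hB : B ⊆ Metric.closedBall 0 r)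
    {z : ℂ} (hz : z ∈ openAngle α β) :
    |harmonicChargeAngle q α β z B| ≤
      genusConst q * powerWeight q (q + 1) ((r / ‖z‖) ^ (Real.pi / (β - α))) := by
  have h := setIntegral_abs_genusKernel_le q hαβ hβ hr hB hz
  rw [harmonicChargeAngle, harmonicChargeUpper_eq q (im_angleMap_pos hαβ hβ hz)
    (isBounded_preimage_angleBoundary hαβ hr hB), abs_mul, abs_of_pos (by positivity)]
  have h1 : 1 / Real.pi ≤ 1 := by
    rw [div_le_one Real.pi_pos]
    linarith [Real.pi_gt_three]
  exact (mul_le_of_le_one_left (abs_nonneg _) h1).trans (abs_integral_le_integral_abs.trans h)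

/-! ### Existence of the balayage -/

lemma measurable_genusKernel_angleMap (q : ℕ) (α β : ℝ) :
    Measurable fun x : ℂ × ℝ => 1 / Real.pi * genusKernel q (angleMap α β x.1) x.2 := by
  have := measurable_angleMap α β
  unfold genusKernel
  fun_prop

/-- If a kernel `F` is absolutely integrable over the preimages of discs, then sweeping `n` along
`F` yields a difference of two locally finite measures. -/
lemma exists_real_sub_eq_integral (n : Measure ℂ) [SFinite n] {F : ℂ × ℝ → ℝ}
    {b : ℝ → ℂ} (hb : Measurable b)
    (hI : ∀ r, 0 < r → Integrable F (n.prod (volume.restrict (b ⁻¹' Metric.closedBall 0 r)))) :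
    ∃ l₁ l₂ : Measure ℂ, IsLocallyFiniteMeasure l₁ ∧ IsLocallyFiniteMeasure l₂ ∧
      ∀ B : Set ℂ, MeasurableSet B → Bornology.IsBounded B →
        l₁.real B - l₂.real B = ∫ z, (∫ t in b ⁻¹' B, F (z, t)) ∂n := by
  have hbs : Measurable fun x : ℂ × ℝ => b x.2 := hb.comp measurable_snd
  have hprod : ∀ E : Set ℝ,
      n.prod (volume.restrict E) = (n.prod volume).restrict (Set.univ ×ˢ E) := fun E => by
    rw [← Measure.prod_restrict, Measure.restrict_univ]
  have happ : ∀ (G : ℂ × ℝ → ℝ) (B : Set ℂ), MeasurableSet B →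
      Measure.map (fun x : ℂ × ℝ => b x.2)
        ((n.prod volume).withDensity fun x => ENNReal.ofReal (G x)) B =
      ∫⁻ x, ENNReal.ofReal (G x) ∂(n.prod (volume.restrict (b ⁻¹' B))) := by
    intro G B hB
    rw [Measure.map_apply hbs hB, withDensity_apply _ (hbs hB), hprod]
    congr 2
    ext x
    simp
  have hlf : ∀ G : ℂ × ℝ → ℝ, (∀ r, 0 < r → Integrable G (n.prod (volume.restrict
      (b ⁻¹' Metric.closedBall 0 r)))) → IsLocallyFiniteMeasure
      (Measure.map (fun x : ℂ × ℝ => b x.2)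
        ((n.prod volume).withDensity fun x => ENNReal.ofReal (G x))) := by
    intro G hG
    refine ⟨fun z => ⟨Metric.closedBall 0 (‖z‖ + 1), ?_, ?_⟩⟩
    · refine Filter.mem_of_superset (Metric.ball_mem_nhds z one_pos) fun w hw => ?_
      have := norm_sub_norm_le w z
      rw [mem_ball_iff_norm] at hw
      rw [mem_closedBall_zero_iff]
      linarith
    · rw [happ G _ measurableSet_closedBall]
      exact (hG _ (by positivity)).lintegral_lt_top
  -- the positive and the negative part of `F` are swept separately
  refine ⟨_, _, hlf F hI, hlf (fun x => -F x) fun r hr => (hI r hr).neg, fun B hB hb' => ?_⟩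
  obtain ⟨r, hr, hBr⟩ := hb'.subset_closedBall_lt 0 0
  have hIB : Integrable F (n.prod (volume.restrict (b ⁻¹' B))) :=
    (hI r hr).mono_measure
      (Measure.prod_mono le_rfl (Measure.restrict_mono (Set.preimage_mono hBr) le_rfl))
  rw [← integral_prod _ hIB, integral_eq_lintegral_pos_part_sub_lintegral_neg_part hIB,
    Measure.real, Measure.real, happ _ _ hB, happ _ _ hB]

instance isLocallyFiniteMeasure_add (m m' : Measure ℂ) [IsLocallyFiniteMeasure m]
    [IsLocallyFiniteMeasure m'] : IsLocallyFiniteMeasure (m + m') := by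
  refine ⟨fun z => ⟨Metric.closedBall z 1, Metric.closedBall_mem_nhds z one_pos, ?_⟩⟩
  rw [Measure.add_apply]
  exact ENNReal.add_lt_top.2 ⟨measure_closedBall_lt_top, measure_closedBall_lt_top⟩

lemma lintegral_ofReal_const_mul {n : Measure ℂ} {g : ℂ → ℝ} {c M : ℝ} (hc : 0 ≤ c)
    (h : ∫⁻ z, ENNReal.ofReal (g z) ∂n ≤ ENNReal.ofReal M) :
    ∫⁻ z, ENNReal.ofReal (c * g z) ∂n ≤ ENNReal.ofReal (c * M) := by
  simp_rw [ENNReal.ofReal_mul hc]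
  rw [lintegral_const_mul' _ _ ENNReal.ofReal_ne_top]
  gcongr

lemma integrable_powerWeight {n : Measure ℂ} {s r M : ℝ} {a b : ℕ} (hr : 0 < r)
    (h : ∫⁻ z, ENNReal.ofReal (powerWeight a b ((r / ‖z‖) ^ s)) ∂n ≤ ENNReal.ofReal M) :
    Integrable (fun z => powerWeight a b ((r / ‖z‖) ^ s)) n := by
  refine (lintegral_ofReal_ne_top_iff_integrable ?_ ?_).1
    (h.trans_lt ENNReal.ofReal_lt_top).ne
  · exact ((measurable_powerWeight a b).comp (by fun_prop)).aestronglyMeasurable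
  · exact Eventually.of_forall fun z => powerWeight_nonneg _ _ (by positivity)

lemma measurable_setIntegral_genusKernel (q : ℕ) (α β : ℝ) (E : Set ℝ) :
    StronglyMeasurable fun z => ∫ t in E, 1 / Real.pi * genusKernel q (angleMap α β z) t :=
  (measurable_genusKernel_angleMap q α β).stronglyMeasurable.integral_prod_right'

/-- On the product of the angle with a bounded piece of the boundary, the kernel is absolutely
integrable as soon as its majorant is integrable over the angle. This licenses Fubini. -/
lemma integrable_genusKernel_prod {n : Measure ℂ} [SFinite n] (q : ℕ) {α β r : ℝ} (hαβ : α < β)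
    (hβ : β ≤ α + 2 * Real.pi) (hr : 0 < r) (hn : ∀ᵐ z ∂n, z ∈ openAngle α β)
    (h : Integrable (fun z => powerWeight q (q + 1) ((r / ‖z‖) ^ (Real.pi / (β - α)))) n) :
    Integrable (fun x : ℂ × ℝ => 1 / Real.pi * genusKernel q (angleMap α β x.1) x.2)
      (n.prod (volume.restrict (angleBoundary α β ⁻¹' Metric.closedBall 0 r))) := by
  have hm := measurable_genusKernel_angleMap q α β
  rw [integrable_prod_iff hm.aestronglyMeasurable]
  constructor
  · filter_upwards [hn] with z hz
    exact (integrableOn_genusKernel q (im_angleMap_pos hαβ hβ hz)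
      (isBounded_preimage_angleBoundary hαβ hr le_rfl)).const_mul _
  · refine Integrable.mono' (h.const_mul (1 / Real.pi * genusConst q))
      hm.norm.stronglyMeasurable.integral_prod_right'.aestronglyMeasurable ?_
    filter_upwards [hn] with z hz
    rw [Real.norm_of_nonneg (integral_nonneg fun t => norm_nonneg _)]
    simp_rw [norm_mul, Real.norm_eq_abs, abs_of_pos (one_div_pos.2 Real.pi_pos)]
    rw [integral_const_mul, mul_assoc]
    gcongr
    exact setIntegral_abs_genusKernel_le q hαβ hβ hr le_rfl hz

lemma ae_harmonicChargeAngle_eq {n : Measure ℂ} (q : ℕ) {α β r : ℝ} (hαβ : α < β)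
    (hβ : β ≤ α + 2 * Real.pi) (hr : 0 < r) (hn : ∀ᵐ z ∂n, z ∈ openAngle α β) {B : Set ℂ}
    (hB : B ⊆ Metric.closedBall 0 r) :
    (fun z => harmonicChargeAngle q α β z B) =ᵐ[n] fun z =>
      ∫ t in angleBoundary α β ⁻¹' B, 1 / Real.pi * genusKernel q (angleMap α β z) t := by
  filter_upwards [hn] with z hz
  rw [harmonicChargeAngle, harmonicChargeUpper_eq q (im_angleMap_pos hαβ hβ hz)
    (isBounded_preimage_angleBoundary hαβ hr hB), integral_const_mul]

lemma integrable_harmonicChargeAngle {n : Measure ℂ} (q : ℕ) {α β r : ℝ} (hαβ : α < β)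
    (hβ : β ≤ α + 2 * Real.pi) (hr : 0 < r) (hn : ∀ᵐ z ∂n, z ∈ openAngle α β) {B : Set ℂ}
    (hB : B ⊆ Metric.closedBall 0 r)
    (h : Integrable (fun z => powerWeight q (q + 1) ((r / ‖z‖) ^ (Real.pi / (β - α)))) n) :
    Integrable (fun z => harmonicChargeAngle q α β z B) n := by
  refine Integrable.mono' (h.const_mul (genusConst q)) ?_ ?_
  · exact (measurable_setIntegral_genusKernel q α β _).aestronglyMeasurable.congr
      (ae_harmonicChargeAngle_eq q hαβ hβ hr hn hB).symm
  · filter_upwards [hn] with z hz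
    exact abs_harmonicChargeAngle_le q hαβ hβ hr hB hz

lemma exists_isAngleBalayage (q : ℕ) {α β : ℝ} (hαβ : α < β) (hβ : β ≤ α + 2 * Real.pi)
    (ν : Charge)
    (h : ∀ r, 0 < r → IntegrableOn
      (fun z => powerWeight q (q + 1) ((r / ‖z‖) ^ (Real.pi / (β - α)))) (openAngle α β) ν.tv) :
    ∃ μ : Charge, IsAngleBalayage q α β ν μ := by
  have hT := measurableSet_openAngle hβ
  have hae (m : Measure ℂ) : ∀ᵐ z ∂(m.restrict (openAngle α β)), z ∈ openAngle α β :=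
    ae_restrict_mem hT
  have hpos : ν.pos ≤ ν.tv := Measure.le_add_right le_rfl
  have hneg : ν.neg ≤ ν.tv := Measure.le_add_left le_rfl
  have hb := measurable_angleBoundary α β
  obtain ⟨l₁, l₂, hl₁, hl₂, hl⟩ := exists_real_sub_eq_integral
    (ν.pos.restrict (openAngle α β)) hb fun r hr =>
      integrable_genusKernel_prod q hαβ hβ hr (hae _) ((h r hr).mono_measure hpos)
  obtain ⟨k₁, k₂, hk₁, hk₂, hk⟩ := exists_real_sub_eq_integral
    (ν.neg.restrict (openAngle α β)) hb fun r hr =>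
      integrable_genusKernel_prod q hαβ hβ hr (hae _) ((h r hr).mono_measure hneg)
  obtain ⟨μ, hμ⟩ := Charge.exists_value_eq_sub
    (l₁ + k₂ + ν.pos.restrict (openAngle α β)ᶜ) (l₂ + k₁ + ν.neg.restrict (openAngle α β)ᶜ)
  refine ⟨μ, fun B hB hbd => ?_⟩
  obtain ⟨r, hr, hBr⟩ := hbd.subset_closedBall_lt 0 0
  refine ⟨integrable_harmonicChargeAngle q hαβ hβ hr (hae _) hBr (h r hr), ?_⟩
  have hfin (m : Measure ℂ) [IsLocallyFiniteMeasure m] : m B ≠ ⊤ := hbd.measure_lt_top.ne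
  rw [hμ B hbd, measureReal_add_apply (hfin _) (hfin _), measureReal_add_apply (hfin _) (hfin _),
    measureReal_add_apply (hfin _) (hfin _), measureReal_add_apply (hfin _) (hfin _),
    measureReal_restrict_apply hB, measureReal_restrict_apply hB, ← Set.sdiff_eq,
    Charge.setIntegral, Charge.value,
    integral_congr_ae (ae_harmonicChargeAngle_eq q hαβ hβ hr (hae ν.pos) hBr),
    integral_congr_ae (ae_harmonicChargeAngle_eq q hαβ hβ hr (hae ν.neg) hBr),
    ← hl B hB hbd, ← hk B hB hbd]
  ring

/-! ### Growth of the balayage -/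

namespace Charge

lemma pos_le_tv (ν : Charge) : ν.pos ≤ ν.tv := Measure.le_add_right le_rfl

lemma neg_le_tv (ν : Charge) : ν.neg ≤ ν.tv := Measure.le_add_left le_rfl

lemma abs_setIntegral_le (ν : Charge) {S : Set ℂ} (hS : MeasurableSet S) {f g : ℂ → ℝ}
    (hfg : ∀ z ∈ S, |f z| ≤ g z) {M : ℝ} (hM : 0 ≤ M)
    (h : ∫⁻ z in S, ENNReal.ofReal (g z) ∂ν.tv ≤ ENNReal.ofReal M) :
    |ν.setIntegral S f| ≤ M := by
  have hle (m : Measure ℂ) : ENNReal.ofReal |∫ z in S, f z ∂m| ≤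
      ∫⁻ z in S, ENNReal.ofReal (g z) ∂m := by
    rw [← Real.norm_eq_abs, ofReal_norm]
    refine (enorm_integral_le_lintegral_enorm _).trans (setLIntegral_mono' hS fun z hz => ?_)
    rw [← ofReal_norm]
    exact ENNReal.ofReal_le_ofReal (hfg z hz)
  rw [tv, Measure.restrict_add, lintegral_add_measure] at h
  have h1 := (add_le_add (hle ν.pos) (hle ν.neg)).trans h
  rw [← ENNReal.ofReal_add (abs_nonneg _) (abs_nonneg _), ENNReal.ofReal_le_ofReal_iff hM] at h1
  exact (abs_sub _ _).trans h1

lemma setIntegral_congr_set_of_null (ν : Charge) {N S T : Set ℂ} (hN : ν.tv N = 0)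
    (f : ℂ → ℝ) : ν.setIntegral ((S \ N) ∩ T) f = ν.setIntegral (S ∩ T) f := by
  have h (m : Measure ℂ) (hm : m ≤ ν.tv) : ((S \ N) ∩ T : Set ℂ) =ᵐ[m] (S ∩ T : Set ℂ) :=
    (sdiff_null_ae_eq_self (le_antisymm ((hm N).trans hN.le) zero_le)).inter
      (ae_eq_refl T)
  rw [setIntegral, setIntegral, setIntegral_congr_set (h _ ν.pos_le_tv),
    setIntegral_congr_set (h _ ν.neg_le_tv)]

lemma abs_value_le_tv (ν : Charge) {B : Set ℂ} {r : ℝ} (hB : B ⊆ Metric.closedBall 0 r) :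
    |ν.value B| ≤ ν.radTV r := by
  have h1 : ν.pos.real B ≤ ν.pos.real (Metric.closedBall 0 r) :=
    measureReal_mono hB measure_closedBall_lt_top.ne
  have h2 : ν.neg.real B ≤ ν.neg.real (Metric.closedBall 0 r) :=
    measureReal_mono hB measure_closedBall_lt_top.ne
  have h3 : 0 ≤ ν.pos.real B := measureReal_nonneg
  have h4 : 0 ≤ ν.neg.real B := measureReal_nonneg
  rw [radTV_eq, value, abs_le]
  constructor <;> linarith

lemma radTV_le_of_hasPowerGrowth (ν : Charge) {A p r : ℝ} (h : HasPowerGrowth ν.tv A p)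
    (hA : 0 ≤ A) (hr : 0 ≤ r) : ν.radTV r ≤ A * r ^ p :=
  ENNReal.toReal_le_of_le_ofReal (by positivity) (h r hr)

end Charge

lemma IsAngleBalayage.radTV_le {q : ℕ} {α β : ℝ} {ν μ : Charge}
    (hμ : IsAngleBalayage q α β ν μ) {r M : ℝ}
    (h : ∀ B, B ⊆ Metric.closedBall 0 r →
      |ν.setIntegral (openAngle α β) (fun z => harmonicChargeAngle q α β z B)| ≤ M) :
    μ.radTV r ≤ 2 * (M + ν.radTV r) := by
  refine μ.radTV_le_of_abs_value_le fun B hB hBr => ?_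
  rw [(hμ B hB (Metric.isBounded_closedBall.subset hBr)).2]
  exact (abs_add_le _ _).trans
    (add_le_add (h B hBr) (ν.abs_value_le_tv (Set.sdiff_subset.trans hBr)))

/-- The total variation of the balayage is controlled by the integral of the majorant. -/
lemma IsAngleBalayage.radTV_le_of_lintegral_powerWeight_le {q : ℕ} {α β : ℝ} (hαβ : α < β)
    (hβ : β ≤ α + 2 * Real.pi) {ν μ : Charge} (hμ : IsAngleBalayage q α β ν μ) {r M : ℝ}
    (hr : 0 < r) (hM : 0 ≤ M)
    (h : ∫⁻ z in openAngle α β, ENNReal.ofReal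
      (powerWeight q (q + 1) ((r / ‖z‖) ^ (Real.pi / (β - α)))) ∂ν.tv ≤ ENNReal.ofReal M) :
    μ.radTV r ≤ 2 * (genusConst q * M + ν.radTV r) :=
  hμ.radTV_le fun _ hB => ν.abs_setIntegral_le (measurableSet_openAngle hβ)
    (fun _ hz => abs_harmonicChargeAngle_le q hαβ hβ hr hB hz)
    (mul_nonneg (genusConst_nonneg q) hM)
    (lintegral_ofReal_const_mul (genusConst_nonneg q) h)

/-- The moment kernel `Im ((z * exp (-i α)) ^ (-π q / (β - α)))`. -/
noncomputable def momentKernel (q : ℕ) (α β : ℝ) (z : ℂ) : ℝ :=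
  (1 / anglePow α (Real.pi * q / (β - α)) z).im

lemma measurable_momentKernel (q : ℕ) (α β : ℝ) : Measurable (momentKernel q α β) := by
  have := measurable_anglePow α (Real.pi * q / (β - α))
  unfold momentKernel
  fun_prop

lemma abs_momentKernel_le (q : ℕ) {α β r : ℝ} (hαβ : α < β) {z : ℂ} (hz0 : z ≠ 0)
    (hz : ‖z‖ < r) : |momentKernel q α β z| ≤ (1 / (r ^ (Real.pi / (β - α))) ^ q) *
      powerWeight q (q + 1) ((r / ‖z‖) ^ (Real.pi / (β - α))) := by
  have hz' : 0 < ‖z‖ := norm_pos_iff.2 hz0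
  have hr : 0 < r := hz'.trans hz
  have hs : 0 < Real.pi / (β - α) := div_pos Real.pi_pos (sub_pos.2 hαβ)
  have h1 : 1 < (r / ‖z‖) ^ (Real.pi / (β - α)) :=
    Real.one_lt_rpow ((one_lt_div hz').2 hz) hs
  rw [powerWeight, if_pos h1, Real.div_rpow hr.le hz'.le, momentKernel, ← angleMap_pow]
  refine (abs_one_div_pow_im_le _ _).trans (le_of_eq ?_)
  rw [norm_angleMap, div_pow]
  have := Real.rpow_pos_of_pos hr (Real.pi / (β - α))
  field_simp

/-- For `|z| < r` the harmonic charge of genus `k + 1` differs from the one of genus `k` by a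
multiple of the moment kernel, and the latter has a majorant of smaller growth at the origin. -/
lemma abs_harmonicChargeAngle_succ_sub_le (k : ℕ) {α β r : ℝ} (hαβ : α < β)
    (hβ : β ≤ α + 2 * Real.pi) (hr : 0 < r) {B : Set ℂ} (hB : B ⊆ Metric.closedBall 0 r)
    {z : ℂ} (hz : z ∈ openAngle α β) :
    |harmonicChargeAngle (k + 1) α β z B - (Metric.ball 0 r).indicator (fun z =>
        ((1 / Real.pi) * ∫ t in angleBoundary α β ⁻¹' B, t ^ k) *
          momentKernel (k + 1) α β z) z| ≤
      (genusConst k + genusConst (k + 1)) *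
        powerWeight k (k + 2) ((r / ‖z‖) ^ (Real.pi / (β - α))) := by
  have hw := im_angleMap_pos hαβ hβ hz
  have hz0 : 0 < ‖z‖ := norm_pos_iff.2 ((mem_openAngle_iff hβ).1 hz).1
  have hs : 0 < Real.pi / (β - α) := div_pos Real.pi_pos (sub_pos.2 hαβ)
  have hx : 0 ≤ (r / ‖z‖) ^ (Real.pi / (β - α)) := by positivity
  have hk := genusConst_nonneg k
  have hk' := genusConst_nonneg (k + 1)
  by_cases h : z ∈ Metric.ball 0 r
  · have h1 : 1 < (r / ‖z‖) ^ (Real.pi / (β - α)) :=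
      Real.one_lt_rpow ((one_lt_div hz0).2 (mem_ball_zero_iff.1 h)) hs
    have hsucc : harmonicChargeAngle (k + 1) α β z B = harmonicChargeAngle k α β z B +
        ((1 / Real.pi) * ∫ t in angleBoundary α β ⁻¹' B, t ^ k) *
          momentKernel (k + 1) α β z := by
      rw [harmonicChargeAngle, harmonicChargeUpper_succ k hw
        (isBounded_preimage_angleBoundary hαβ hr hB), momentKernel, ← angleMap_pow]
      rfl
    rw [Set.indicator_of_mem h, hsucc, add_sub_cancel_right]
    refine (abs_harmonicChargeAngle_le k hαβ hβ hr hB hz).trans ?_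
    rw [powerWeight, powerWeight, if_pos h1, if_pos h1]
    gcongr
    linarith
  · have h1 : ¬ 1 < (r / ‖z‖) ^ (Real.pi / (β - α)) := by
      refine not_lt.2 (Real.rpow_le_one (by positivity) ?_ hs.le)
      exact div_le_one_of_le₀ (by simpa using h) hz0.le
    rw [Set.indicator_of_notMem h, sub_zero]
    refine (abs_harmonicChargeAngle_le (k + 1) hαβ hβ hr hB hz).trans ?_
    rw [powerWeight, powerWeight, if_neg h1, if_neg h1]
    gcongr
    linarith

/-- The part of the balayage that is swept out of the angle, split into the moment and a remainder
of order `r ^ p`. -/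
lemma exists_abs_setIntegral_harmonicChargeAngle_le {q : ℕ} {α β p A r₀ : ℝ} (hαβ : α < β)
    (hβ : β ≤ α + 2 * Real.pi) {ν : Charge} (h : HasPowerGrowth ν.tv A p) (hA : 0 ≤ A)
    (hp : 0 ≤ p) (hr₀ : 0 < r₀) (hn : ν.tv (Metric.ball 0 r₀) = 0)
    (hq : Real.pi / (β - α) * q ≤ p) (hq' : p < Real.pi / (β - α) * (q + 1 : ℕ)) :
    ∃ C : ℝ, 0 ≤ C ∧ ∀ r, 0 < r → ∀ B, B ⊆ Metric.closedBall 0 r →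
      |ν.setIntegral (openAngle α β) (fun z => harmonicChargeAngle q α β z B)| ≤
        C * r ^ p + r ^ (Real.pi * q / (β - α)) *
          |ν.setIntegral (Metric.ball 0 r ∩ openAngle α β) (momentKernel q α β)| := by
  have hT := measurableSet_openAngle hβ
  have hs : 0 < Real.pi / (β - α) := div_pos Real.pi_pos (sub_pos.2 hαβ)
  have hg : HasPowerGrowth (ν.tv.restrict (openAngle α β)) A p := h.mono Measure.restrict_le_self
  obtain _ | k := q
  -- in genus `0` there is no moment term
  · obtain ⟨C, hC, hC'⟩ := hg.exists_lintegral_powerWeight_le hA hp hs (a := 0) (b := 1)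
      (Or.inl (by simp)) (by simpa using hq')
    refine ⟨genusConst 0 * C, mul_nonneg (genusConst_nonneg 0) hC, fun r hr B hB => ?_⟩
    refine (ν.abs_setIntegral_le hT (fun z hz => abs_harmonicChargeAngle_le 0 hαβ hβ hr hB hz)
      (M := genusConst 0 * (C * r ^ p)) ?_
      (lintegral_ofReal_const_mul (genusConst_nonneg 0) (hC' r hr))).trans ?_
    · have := genusConst_nonneg 0
      positivity
    · rw [mul_assoc]
      exact le_add_of_nonneg_right (by positivity)
  · have hk : Real.pi / (β - α) * k < p := by
      refine lt_of_lt_of_le ?_ hq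
      push_cast
      nlinarith
    obtain ⟨C, hC, hC'⟩ := hg.exists_lintegral_powerWeight_le hA hp hs (a := k) (b := k + 2)
      (Or.inr hk) hq'
    obtain ⟨D, -, hD'⟩ := hg.exists_lintegral_powerWeight_le_log hA hp hs hq hq' hr₀
      (le_antisymm ((Measure.restrict_apply_le _ _).trans hn.le) zero_le)
    have hc0 : 0 ≤ genusConst k + genusConst (k + 1) :=
      add_nonneg (genusConst_nonneg _) (genusConst_nonneg _)
    refine ⟨(genusConst k + genusConst (k + 1)) * C, mul_nonneg hc0 hC, fun r hr B hB => ?_⟩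
    have hW : IntegrableOn (fun z => powerWeight (k + 1) (k + 1 + 1)
        ((r / ‖z‖) ^ (Real.pi / (β - α)))) (openAngle α β) ν.tv :=
      integrable_powerWeight hr (hD' r hr)
    have hmom : IntegrableOn ((Metric.ball 0 r).indicator (momentKernel (k + 1) α β))
        (openAngle α β) ν.tv := by
      refine Integrable.mono' (hW.const_mul (1 / (r ^ (Real.pi / (β - α))) ^ (k + 1)))
        ((measurable_momentKernel _ α β).indicator measurableSet_ball).aestronglyMeasurable ?_
      filter_upwards [ae_restrict_mem hT] with z hz
      by_cases hzr : z ∈ Metric.ball 0 r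
      · rw [Set.indicator_of_mem hzr, Real.norm_eq_abs]
        exact abs_momentKernel_le (k + 1) hαβ ((mem_openAngle_iff hβ).1 hz).1
          (mem_ball_zero_iff.1 hzr)
      · rw [Set.indicator_of_notMem hzr, norm_zero]
        exact mul_nonneg (by positivity) (powerWeight_nonneg _ _ (by positivity))
    set c := (1 / Real.pi) * ∫ t in angleBoundary α β ⁻¹' B, t ^ k with hc
    have hcr : |c| ≤ r ^ (Real.pi * (k + 1 : ℕ) / (β - α)) := by
      refine (abs_integral_pow_le (Real.rpow_pos_of_pos hr _) k
        (preimage_angleBoundary_subset hαβ hr.le hB)).trans (le_of_eq ?_)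
      rw [← Real.rpow_natCast, ← Real.rpow_mul hr.le]
      congr 1
      ring
    have hind : (Metric.ball 0 r).indicator (fun z => c * momentKernel (k + 1) α β z) =
        fun z => c * (Metric.ball 0 r).indicator (momentKernel (k + 1) α β) z := by
      ext z
      rw [Set.indicator_const_mul]
    have hsplit (m : Measure ℂ) (hm : m ≤ ν.tv) :
        ∫ z in openAngle α β, harmonicChargeAngle (k + 1) α β z B ∂m =
          (∫ z in openAngle α β, (harmonicChargeAngle (k + 1) α β z B -
            (Metric.ball 0 r).indicator (fun z => c * momentKernel (k + 1) α β z) z) ∂m) +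
          c * ∫ z in Metric.ball 0 r ∩ openAngle α β, momentKernel (k + 1) α β z ∂m := by
      have h1 := integrable_harmonicChargeAngle (k + 1) hαβ hβ hr (ae_restrict_mem hT) hB
        (hW.mono_measure hm)
      rw [hind, integral_sub h1 ((hmom.mono_measure hm).const_mul c), integral_const_mul,
        setIntegral_indicator measurableSet_ball, Set.inter_comm, sub_add_cancel]
    have hsplit' : ν.setIntegral (openAngle α β)
        (fun z => harmonicChargeAngle (k + 1) α β z B) =
        ν.setIntegral (openAngle α β) (fun z => harmonicChargeAngle (k + 1) α β z B -
            (Metric.ball 0 r).indicator (fun z => c * momentKernel (k + 1) α β z) z) +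
        c * ν.setIntegral (Metric.ball 0 r ∩ openAngle α β) (momentKernel (k + 1) α β) := by
      rw [Charge.setIntegral, Charge.setIntegral, Charge.setIntegral, hsplit _ ν.pos_le_tv,
        hsplit _ ν.neg_le_tv]
      ring
    rw [hsplit']
    refine (abs_add_le _ _).trans (add_le_add ?_ ?_)
    · rw [mul_assoc]
      exact ν.abs_setIntegral_le hT
        (fun z hz => abs_harmonicChargeAngle_succ_sub_le k hαβ hβ hr hB hz) (by positivity)
        (lintegral_ofReal_const_mul hc0 (hC' r hr))
    · rw [abs_mul]
      gcongr

/-- The growth bound in terms of the moments. At radius `0` it follows by letting `r → 0+`, as the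
moments vanish near the origin. -/
lemma IsAngleBalayage.exists_radTV_le {q : ℕ} {α β p A r₁ : ℝ} (hαβ : α < β)
    (hβ : β ≤ α + 2 * Real.pi) {ν μ : Charge} (hμ : IsAngleBalayage q α β ν μ)
    (h : HasPowerGrowth ν.tv A p) (hA : 0 ≤ A) (hp : 0 ≤ p) (hr₁ : 0 < r₁)
    (hn : ν.tv (Metric.ball 0 r₁) = 0)
    (hq : Real.pi / (β - α) * q ≤ p) (hq' : p < Real.pi / (β - α) * (q + 1 : ℕ)) :
    ∃ C : ℝ, ∀ r₀ : ℝ, 0 < r₀ → Metric.ball 0 r₀ ∩ ν.support = ∅ → ∀ r : ℝ, 0 ≤ r →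
      μ.radTV r ≤ C * (r ^ p + r ^ (Real.pi * q / (β - α)) *
        |angleMoment ν α β (Real.pi * q / (β - α)) r₀ r|) := by
  obtain ⟨C, hC, hC'⟩ :=
    exists_abs_setIntegral_harmonicChargeAngle_le hαβ hβ h hA hp hr₁ hn hq hq'
  have key (r : ℝ) (hr : 0 < r) : μ.radTV r ≤ 2 * (C + A + 1) * (r ^ p +
      r ^ (Real.pi * q / (β - α)) *
        |ν.setIntegral (Metric.ball 0 r ∩ openAngle α β) (momentKernel q α β)|) := by
    have h1 := hμ.radTV_le (hC' r hr)
    have h2 := ν.radTV_le_of_hasPowerGrowth h hA hr.le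
    have h3 : 0 ≤ r ^ p := by positivity
    have h4 : 0 ≤ r ^ (Real.pi * q / (β - α)) *
      |ν.setIntegral (Metric.ball 0 r ∩ openAngle α β) (momentKernel q α β)| := by positivity
    nlinarith [mul_nonneg hC h4, mul_nonneg hA h4]
  -- the constant does not depend on `r₀`, since all admissible `r₀` give the same moments
  refine ⟨2 * (C + A + 1), fun r₀ hr₀ hr₀ν r hr => ?_⟩
  have hn₀ := ν.tv_ball_eq_zero hr₀ν
  rcases hr.eq_or_lt with rfl | hr
  · have hsmall : ∀ᶠ r in 𝓝[>] (0 : ℝ), μ.radTV 0 ≤ 2 * (C + A + 1) * r ^ p := by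
      filter_upwards [Ioo_mem_nhdsGT hr₀] with r hr
      refine (μ.radTV_mono hr.1.le).trans ((key r hr.1).trans (le_of_eq ?_))
      have hz (m : Measure ℂ) (hm : m ≤ ν.tv) :
          ∫ z in Metric.ball 0 r ∩ openAngle α β, momentKernel q α β z ∂m = 0 := by
        refine setIntegral_measure_zero _ (measure_mono_null
          (Set.inter_subset_left.trans (Metric.ball_subset_ball hr.2.le))
          (le_antisymm ((hm _).trans hn₀.le) zero_le))
      rw [Charge.setIntegral, hz _ ν.pos_le_tv, hz _ ν.neg_le_tv]
      simp
    have hlim : Tendsto (fun r : ℝ => 2 * (C + A + 1) * r ^ p) (𝓝[>] 0)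
        (𝓝 (2 * (C + A + 1) * 0 ^ p)) :=
      ((Real.continuousAt_rpow_const 0 p (Or.inr hp)).tendsto.mono_left
        nhdsWithin_le_nhds).const_mul _
    refine (ge_of_tendsto hlim hsmall).trans ?_
    gcongr
    exact le_add_of_nonneg_right (by positivity)
  · refine (key r hr).trans (le_of_eq ?_)
    rw [angleMoment, ν.setIntegral_congr_set_of_null hn₀]
    rfl

lemma one_add_log_isBigO_log {r₀ : ℝ} (hr₀ : 0 < r₀) :
    (fun r : ℝ => 1 + Real.log (1 + r / r₀)) =O[atTop] Real.log := by
  refine IsBigO.of_bound 3 ?_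
  filter_upwards [eventually_ge_atTop (Real.exp 1), eventually_ge_atTop (1 + 1 / r₀)]
    with r hr hr'
  have hr0 : 0 < r := (Real.exp_pos 1).trans_le hr
  have h1 : 1 ≤ Real.log r := (Real.le_log_iff_exp_le hr0).2 hr
  have h2 : 1 ≤ r := le_trans (by linarith [one_div_pos.2 hr₀]) hr'
  have h3 : Real.log (1 + r / r₀) ≤ 2 * Real.log r := by
    rw [show 2 * Real.log r = Real.log (r ^ 2) by rw [Real.log_pow, Nat.cast_ofNat]]
    refine Real.log_le_log (by positivity) ?_
    have : r * (1 + 1 / r₀) ≤ r * r := by gcongr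
    rw [mul_add, mul_one_div, mul_one] at this
    nlinarith
  have h4 : 0 ≤ Real.log (1 + r / r₀) := Real.log_nonneg (le_add_of_nonneg_right (by positivity))
  rw [Real.norm_of_nonneg (by linarith), Real.norm_of_nonneg (by linarith)]
  linarith

theorem mainTheorem4 (α β : ℝ) (hαβ : α < β) (hβ : β ≤ α + 2 * Real.pi)
    (p : ℝ) (hp : 0 ≤ p) (ν : Charge) (hν : ν.FiniteType p) (h0 : (0 : ℂ) ∉ ν.support)
    (q : ℕ) (hq : q = ⌊(β - α) / Real.pi * p⌋₊) :
    (∃! μ : Charge, IsAngleBalayage q α β ν μ) ∧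
    ∀ μ : Charge, IsAngleBalayage q α β ν μ →
      (∃ C : ℝ, ∀ r₀ : ℝ, 0 < r₀ → Metric.ball 0 r₀ ∩ ν.support = ∅ → ∀ r : ℝ, 0 ≤ r →
        μ.radTV r ≤ C * (r ^ p + r ^ (Real.pi * q / (β - α)) *
          |angleMoment ν α β (Real.pi * q / (β - α)) r₀ r|)) ∧
      (μ.radTV =O[atTop] fun r : ℝ => r ^ p * Real.log r) ∧
      ((¬ ∃ n : ℕ, (β - α) / Real.pi * p = n) → μ.FiniteType p) ∧
      ((∃ n : ℕ, (β - α) / Real.pi * p = n) →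
        ∀ r₀ : ℝ, 0 < r₀ → Metric.ball 0 r₀ ∩ ν.support = ∅ →
          BlaschkeCondition ν α β p r₀ → μ.FiniteType p) := by
  have hd : 0 < β - α := sub_pos.2 hαβ
  have hs : 0 < Real.pi / (β - α) := div_pos Real.pi_pos hd
  have hκ : 0 ≤ (β - α) / Real.pi * p := mul_nonneg (div_pos hd Real.pi_pos).le hp
  have hsκ : Real.pi / (β - α) * ((β - α) / Real.pi * p) = p := by
    have := Real.pi_ne_zero
    field_simp
  have hfl : (q : ℝ) ≤ (β - α) / Real.pi * p := hq ▸ Nat.floor_le hκ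
  have hq1 : Real.pi / (β - α) * q ≤ p := by
    rw [← hsκ]
    gcongr
  have hq2 : p < Real.pi / (β - α) * (q + 1 : ℕ) := by
    calc p = Real.pi / (β - α) * ((β - α) / Real.pi * p) := hsκ.symm
      _ < _ := by
        gcongr
        push_cast
        exact hq ▸ Nat.lt_floor_add_one _
  obtain ⟨A, hA, hg⟩ := ν.exists_hasPowerGrowth hp hν h0
  obtain ⟨r₁, hr₁, hn⟩ := ν.exists_ball_null h0
  have hgT : HasPowerGrowth (ν.tv.restrict (openAngle α β)) A p :=
    hg.mono Measure.restrict_le_self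
  obtain ⟨D, hD, hD'⟩ := hgT.exists_lintegral_powerWeight_le_log hA hp hs hq1 hq2 hr₁
    (le_antisymm ((Measure.restrict_apply_le _ _).trans hn.le) zero_le)
  refine ⟨?_, fun μ hμ => ?_⟩
  · obtain ⟨μ, hμ⟩ := exists_isAngleBalayage q hαβ hβ ν fun r hr =>
      integrable_powerWeight hr (hD' r hr)
    exact ⟨μ, hμ, fun μ' hμ' => Charge.ext_of_value fun B hB hb =>
      (hμ' B hB hb).2.trans (hμ B hB hb).2.symm⟩
  have hmain := hμ.exists_radTV_le hαβ hβ hg hA hp hr₁ hn hq1 hq2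
  have hCq := genusConst_nonneg q
  refine ⟨hmain, ?_, fun hnot => ?_, ?_⟩
  · have h1 : μ.radTV =O[atTop] fun r : ℝ => r ^ p * (1 + Real.log (1 + r / r₁)) := by
      refine IsBigO.of_bound (2 * (genusConst q * D + A)) ?_
      filter_upwards [eventually_gt_atTop 0] with r hr
      have hrp : 0 ≤ r ^ p := by positivity
      have hl : 0 ≤ Real.log (1 + r / r₁) :=
        Real.log_nonneg (le_add_of_nonneg_right (by positivity))
      have h2 := hμ.radTV_le_of_lintegral_powerWeight_le hαβ hβ hr (by positivity) (hD' r hr)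
      have h3 := ν.radTV_le_of_hasPowerGrowth hg hA hr.le
      rw [Real.norm_of_nonneg (show 0 ≤ μ.radTV r from measureReal_nonneg),
        Real.norm_of_nonneg (by positivity)]
      refine h2.trans ?_
      have h4 : 0 ≤ A * r ^ p * Real.log (1 + r / r₁) := by positivity
      linear_combination 2 * h3 + 2 * h4
    exact h1.trans ((isBigO_refl _ _).mul (one_add_log_isBigO_log hr₁))
  · have hlt : Real.pi / (β - α) * q < p := by
      calc _ < Real.pi / (β - α) * ((β - α) / Real.pi * p) := by
            gcongr
            exact hfl.lt_of_ne fun h => hnot ⟨q, h.symm⟩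
        _ = p := hsκ
    obtain ⟨C, hC, hC'⟩ := hgT.exists_lintegral_powerWeight_le hA hp hs (Or.inr hlt) hq2
    refine μ.finiteType_of_radTV_le (C := 2 * (genusConst q * C + A)) ?_
    filter_upwards [eventually_gt_atTop 0] with r hr
    have h2 := hμ.radTV_le_of_lintegral_powerWeight_le hαβ hβ hr (by positivity) (hC' r hr)
    have h3 := ν.radTV_le_of_hasPowerGrowth hg hA hr.le
    linear_combination h2 + 2 * h3
  · rintro ⟨n, hpn⟩ r₀ hr₀ hr₀ν hB
    have hqn : q = n := by rw [hq, hpn, Nat.floor_natCast]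
    have hexp : Real.pi * q / (β - α) = p := by
      rw [hqn, ← hpn]
      have := Real.pi_ne_zero
      field_simp
    obtain ⟨C, hC⟩ := hmain
    obtain ⟨K, hK⟩ := hB.bound
    refine μ.finiteType_of_radTV_le (C := |C| * (1 + K)) ?_
    filter_upwards [hK, eventually_gt_atTop 0] with r hrK hr
    have h1 := hC r₀ hr₀ hr₀ν r hr.le
    rw [hexp] at h1
    rw [norm_one, mul_one, Real.norm_eq_abs, abs_abs] at hrK
    calc μ.radTV r ≤ _ := h1
      _ ≤ |C| * (r ^ p + r ^ p * |angleMoment ν α β p r₀ r|) := by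
          gcongr
          exact le_abs_self C
      _ ≤ |C| * (r ^ p + r ^ p * K) := by gcongr
      _ = _ := by ring
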